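/- Let $\mathbf X=(X(t),\,t\in\mathbb R)$ be a real-valued stochastic process on a probability space $(\Omega,\mathcal F,P)$ which has upper semicontinuous sample paths, is stationary (its finite-dimensional distributions are invariant under time shifts), and is separable, in the sense that there is a countable set $S\subset\mathbb R$ such that, almost surely, $\sup_{t\in U}X(t)=\sup_{t\in U\cap S}X(t)$ for every open set $U\subseteq\mathbb R$ (this is automatic for continuous paths). Assume: (TailSM) there is a function $\varphi:(0,\infty)\to\mathbb R$ such that $P\bigl(\sup_{0\le s\le t}X(s)\ge\varphi(t)\bigr)\to1$ as $t\to\infty$, and $$\sup\bigl\{|P(A\cap B)-P(A)P(B)|:\ A\in\sigma\bigl(X(s)\mathbf 1(X(s)\ge\varphi(t)),\,s\le0\bigr),\ B\in\sigma\bigl(X(s)\mathbf 1(X(s)\ge\varphi(t)),\,s\ge t\bigr)\bigr\}\to0\quad\text{as }t\to\infty;$$ (A) $\displaystyle\lim_{T\to\infty}\sup_{x\in\mathbb R}P\bigl(\sup_{t\in[0,T]}X(t)=x\bigr)=0.$ For $T>0$ let $\tau_{\mathbf X,T}=\min\{t\in[0,T]:X(t)=\sup_{0\le s\le T}X(s)\}$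 be the leftmost location of the supremum over $[0,T]$. Then $\tau_{\mathbf X,T}$ is a random variable (measurable up to a $P$-null set), and its law restricted to $(0,T)$ is absolutely continuous with a (necessarily unique) nonnegative density $f_{\mathbf X,T}$ on $(0,T)$ that is right continuous with left limits. This density satisfies $$\lim_{T\to\infty}\ \sup_{\varepsilon\le t\le1-\varepsilon}\bigl|T f_{\mathbf X,T}(tT)-1\bigr|=0\qquad\text{for every }0<\varepsilon<1/2,$$ and the law of $\tau_{\mathbf X,T}/T$ converges weakly, as $T\to\infty$, to the uniform distribution on $(0,1)$. -/

import Mathlib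

open MeasureTheory ProbabilityTheory Set Filter Topology

noncomputable section

namespace SupLocation

variable {Ω : Type*}

/-- The supremum `sup_{a ≤ s ≤ b} X(s)` of the path over the compact interval `[a, b]`. -/
def supOn (X : ℝ → Ω → ℝ) (a b : ℝ) (ω : Ω) : ℝ :=
  sSup ((fun s => X s ω) '' Icc a b)

/-- The leftmost location of the supremum of the path over `[a, b]`. For an upper semicontinuous
path the set below is compact and, if `a ≤ b`, nonempty, so that the infimum is a minimum. -/
def supLoc (X : ℝ → Ω → ℝ) (a b : ℝ) (ω : Ω) : ℝ :=
  sInf {t ∈ Icc a b | X t ω = supOn X a b ω}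

/-- All sample paths are upper semicontinuous. -/
def SampleUSC (X : ℝ → Ω → ℝ) : Prop :=
  ∀ ω, UpperSemicontinuous fun t => X t ω

/-- Stationarity: the finite-dimensional distributions are invariant under time shifts. -/
def IsStationary [MeasurableSpace Ω] (X : ℝ → Ω → ℝ) (P : Measure Ω) : Prop :=
  ∀ (n : ℕ) (t : Fin n → ℝ) (h : ℝ),
    P.map (fun ω i => X (t i + h) ω) = P.map (fun ω i => X (t i) ω)

/-- Separability (for suprema): for some countable set `S` of times, almost surely the supremum
of the path over every open set `U` of times equals its supremum over `U ∩ S`. -/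
def IsSupSeparable [MeasurableSpace Ω] (X : ℝ → Ω → ℝ) (P : Measure Ω) : Prop :=
  ∃ S : Set ℝ, S.Countable ∧ ∀ᵐ ω ∂P, ∀ U : Set ℝ, IsOpen U →
    ∀ t ∈ U, ∀ c < X t ω, ∃ s ∈ U ∩ S, c < X s ω

/-- The strong mixing (Rosenblatt) coefficient
`sup {|P(A ∩ B) - P(A) P(B)| : A ∈ 𝒜, B ∈ ℬ}` of two σ-algebras. -/
def mixingCoeff [MeasurableSpace Ω] (P : Measure Ω) (𝒜 ℬ : MeasurableSpace Ω) : ℝ :=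
  sSup {x : ℝ | ∃ A B : Set Ω, MeasurableSet[𝒜] A ∧ MeasurableSet[ℬ] B ∧
    x = |P.real (A ∩ B) - P.real A * P.real B|}

/-- The part `X(s) 1(X(s) ≥ u)` of the process at or above the level `u`. -/
def highPart (X : ℝ → Ω → ℝ) (u : ℝ) (s : ℝ) : Ω → ℝ :=
  indicator {ω | u ≤ X s ω} (X s)

/-- The σ-algebra `σ(Y(s), s ∈ I)`. -/
@[reducible] def sigmaOf (Y : ℝ → Ω → ℝ) (I : Set ℝ) : MeasurableSpace Ω :=
  ⨆ s ∈ I, MeasurableSpace.comap (Y s) (borel ℝ)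

/-- Strong mixing of the high-level part of the process. -/
def TailSM [MeasurableSpace Ω] (X : ℝ → Ω → ℝ) (P : Measure Ω) : Prop :=
  ∃ φ : ℝ → ℝ,
    Tendsto (fun t : ℝ => P {ω | φ t ≤ supOn X 0 t ω}) atTop (𝓝 1) ∧
    Tendsto (fun t : ℝ => mixingCoeff P
      (sigmaOf (highPart X (φ t)) (Iic 0)) (sigmaOf (highPart X (φ t)) (Ici t)))
      atTop (𝓝 0)

/-- The largest atom of the law of the supremum over `[0, T]` vanishes as `T → ∞`. -/
def AtomsVanish [MeasurableSpace Ω] (X : ℝ → Ω → ℝ) (P : Measure Ω) : Prop :=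
  Tendsto (fun T : ℝ => ⨆ x : ℝ, P {ω | supOn X 0 T ω = x}) atTop (𝓝 0)

/-- `f` is a nonnegative function on `(0, T)`, right continuous with (finite) left limits there,
and is the density in `(0, T)` of the law of the leftmost supremum location over `[0, T]`.
Nothing is required of `f` outside `(0, T)`. -/
structure IsSupLocDensity [MeasurableSpace Ω] (X : ℝ → Ω → ℝ) (P : Measure Ω) (T : ℝ)
    (f : ℝ → ℝ) : Prop where
  nonneg : ∀ t ∈ Ioo 0 T, 0 ≤ f t
  rightCts : ∀ t ∈ Ioo 0 T, ContinuousWithinAt f (Ici t) t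
  leftLim : ∀ t ∈ Ioo 0 T, ∃ l : ℝ, Tendsto f (𝓝[<] t) (𝓝 l)
  density : (P.map (supLoc X 0 T)).restrict (Ioo 0 T) =
    (volume.restrict (Ioo 0 T)).withDensity fun t => ENNReal.ofReal (f t)

end SupLocation

end

noncomputable section

namespace SupLocation

variable {Ω : Type*} {X : ℝ → Ω → ℝ} {ω : Ω} {a b c x y a' b' : ℝ}

/-! ### Suprema and their leftmost locations for a single path -/

/-! Let `H a b` be the probability that the leftmost maximum over `[-a, b]` lies in `(0, e]`; by
stationarity this is the mass of `(a, a + e]` under the law of the location over `[0, a + b]`. A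
maximum over a large window is a maximum over each smaller window containing it, so `H` decreases in
both arguments. A common leftmost maximum of two overlapping windows is one of their union, so the
loss from extending the window to the left shrinks when the right end moves out. These two facts
form `IsLocFamily`, and everything about densities is deduced from them alone.

Existence: monotonicity makes the law locally Lipschitz inside `(0, T)`, hence absolutely continuous
there. The second inequality bounds the variation of the limiting intensity, so its right limits
give a density that is right continuous with left limits (`IsLocFamily.exists_density`).

Equidistribution: take `n` equal blocks separated by gaps proportional to `T`. Above the level `φ`
mixing makes the block suprema nearly independent. They are identically distributed with small
atoms, so each is the largest with probability close to `1 / n` (`block_strict_lower_bound`,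
`eventually_block_le`). The location therefore falls in a given block with probability at most about
`1 / n`. Upper bounds for all cells of a partition suffice, as the masses add up to one, and the
rescaled distribution functions converge uniformly (`IsLocFamily.eventually_abs_cdf_sub_le`).

Densities: monotonicity squeezes the density at `y` between average masses over intervals of length
`Δ` adjacent to `y`, for the windows `T + Δ` and `T - Δ`. With `Δ = η * T` this upgrades convergence
of distribution functions to uniform convergence of densities. -/

lemma bddAbove_path (h : UpperSemicontinuous fun t => X t ω) (a b : ℝ) :
    BddAbove ((fun s => X s ω) '' Icc a b) :=
  (h.upperSemicontinuousOn _).bddAbove_of_isCompact isCompact_Icc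

lemma le_supOn (h : UpperSemicontinuous fun t => X t ω) (hx : x ∈ Icc a b) :
    X x ω ≤ supOn X a b ω :=
  le_csSup (bddAbove_path h a b) (mem_image_of_mem _ hx)

lemma exists_eq_supOn (h : UpperSemicontinuous fun t => X t ω) (hab : a ≤ b) :
    ∃ t ∈ Icc a b, X t ω = supOn X a b ω := by
  obtain ⟨t, ht, hmax⟩ := UpperSemicontinuousOn.exists_isMaxOn (nonempty_Icc.2 hab)
    isCompact_Icc (h.upperSemicontinuousOn _)
  refine ⟨t, ht, le_antisymm (le_supOn h ht) ?_⟩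
  refine csSup_le ((nonempty_Icc.2 hab).image _) ?_
  rintro _ ⟨s, hs, rfl⟩
  exact hmax hs

lemma supOn_le_iff (h : UpperSemicontinuous fun t => X t ω) (hab : a ≤ b) :
    supOn X a b ω ≤ c ↔ ∀ t ∈ Icc a b, X t ω ≤ c := by
  refine ⟨fun hc t ht => (le_supOn h ht).trans hc, fun hc => ?_⟩
  obtain ⟨t, ht, e⟩ := exists_eq_supOn h hab
  exact e ▸ hc t ht

lemma supOn_mono (h : UpperSemicontinuous fun t => X t ω) (hab : a ≤ b) (ha : a' ≤ a)
    (hb : b ≤ b') : supOn X a b ω ≤ supOn X a' b' ω :=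
  (supOn_le_iff h hab).2 fun _ ht => le_supOn h ⟨ha.trans ht.1, ht.2.trans hb⟩

/-- `x` is the leftmost location of the maximum of the path over `[a, b]`. -/
def IsLeftmostMax (X : ℝ → Ω → ℝ) (ω : Ω) (a b x : ℝ) : Prop :=
  x ∈ Icc a b ∧ (∀ y ∈ Ico a x, X y ω < X x ω) ∧ ∀ y ∈ Icc x b, X y ω ≤ X x ω

lemma isLeast_supLoc (h : UpperSemicontinuous fun t => X t ω) (hab : a ≤ b) :
    IsLeast {t ∈ Icc a b | X t ω = supOn X a b ω} (supLoc X a b ω) := by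
  have hset : {t ∈ Icc a b | X t ω = supOn X a b ω} =
      Icc a b ∩ (fun t => X t ω) ⁻¹' Ici (supOn X a b ω) := by
    ext t
    simp only [mem_ofPred_eq, mem_inter_iff, mem_preimage, mem_Ici]
    exact and_congr_right fun ht => ⟨fun e => e.ge, fun e => le_antisymm (le_supOn h ht) e⟩
  have hcl : IsCompact {t ∈ Icc a b | X t ω = supOn X a b ω} := by
    rw [hset]
    exact isCompact_Icc.inter_right (h.isClosed_preimage _)
  obtain ⟨t, ht, e⟩ := exists_eq_supOn h hab
  exact hcl.isLeast_sInf ⟨t, ht, e⟩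

lemma supLoc_mem_Icc (h : UpperSemicontinuous fun t => X t ω) (hab : a ≤ b) :
    supLoc X a b ω ∈ Icc a b :=
  (isLeast_supLoc h hab).1.1

lemma apply_supLoc (h : UpperSemicontinuous fun t => X t ω) (hab : a ≤ b) :
    X (supLoc X a b ω) ω = supOn X a b ω :=
  (isLeast_supLoc h hab).1.2

lemma isLeftmostMax_supLoc (h : UpperSemicontinuous fun t => X t ω) (hab : a ≤ b) :
    IsLeftmostMax X ω a b (supLoc X a b ω) := by
  have hl := isLeast_supLoc h hab
  refine ⟨hl.1.1, fun y hy => ?_, fun y hy => ?_⟩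
  · have hyb : y ∈ Icc a b := ⟨hy.1, hy.2.le.trans hl.1.1.2⟩
    refine lt_of_le_of_ne ((le_supOn h hyb).trans hl.1.2.ge) fun e => ?_
    exact absurd (hl.2 ⟨hyb, e.trans hl.1.2⟩) (not_le.2 hy.2)
  · exact (le_supOn h ⟨hl.1.1.1.trans hy.1, hy.2⟩).trans hl.1.2.ge

lemma supLoc_eq_iff (h : UpperSemicontinuous fun t => X t ω) (hab : a ≤ b) :
    supLoc X a b ω = x ↔ IsLeftmostMax X ω a b x := by
  refine ⟨fun e => e ▸ isLeftmostMax_supLoc h hab, fun hx => ?_⟩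
  have hl := isLeftmostMax_supLoc h hab
  rcases lt_trichotomy (supLoc X a b ω) x with hlt | heq | hgt
  · exact absurd (hx.2.1 _ ⟨hl.1.1, hlt⟩) (not_lt.2 (hl.2.2 _ ⟨hlt.le, hx.1.2⟩))
  · exact heq
  · exact absurd (hl.2.1 _ ⟨hx.1.1, hgt⟩) (not_lt.2 (hx.2.2 _ ⟨hgt.le, hl.1.2⟩))

lemma IsLeftmostMax.mono (hx : IsLeftmostMax X ω a' b' x) (ha : a' ≤ a) (hb : b ≤ b')
    (hxab : x ∈ Icc a b) : IsLeftmostMax X ω a b x :=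
  ⟨hxab, fun y hy => hx.2.1 y ⟨ha.trans hy.1, hy.2⟩, fun y hy => hx.2.2 y ⟨hy.1, hy.2.trans hb⟩⟩

/-- The location of the supremum over a window is also the one over any smaller window
containing it. -/
lemma supLoc_eq_of_subset (h : UpperSemicontinuous fun t => X t ω) (hab : a ≤ b) (ha : a' ≤ a)
    (hb : b ≤ b') (hx : supLoc X a' b' ω ∈ Icc a b) : supLoc X a b ω = supLoc X a' b' ω :=
  (supLoc_eq_iff h hab).2
    ((isLeftmostMax_supLoc h (ha.trans (hab.trans hb))).mono ha hb hx)

/-- A point that is the location of the supremum over two windows is so over their union. -/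
lemma supLoc_eq_of_eq_of_eq (h : UpperSemicontinuous fun t => X t ω) (hab' : a ≤ b')
    (ha'b : a' ≤ b) (ha : a' ≤ a) (h₁ : supLoc X a b' ω = x)
    (h₂ : supLoc X a' b ω = x) : supLoc X a' b' ω = x := by
  rw [supLoc_eq_iff h hab'] at h₁
  rw [supLoc_eq_iff h ha'b] at h₂
  rw [supLoc_eq_iff h (ha.trans hab')]
  exact ⟨⟨h₂.1.1, h₁.1.2⟩, h₂.2.1, h₁.2.2⟩

/-- Location events become comparisons of two suprema, which is how measurability and shift
invariance reach `supLoc`. Choosing the leftmost maximum is what makes ties count towards `[a, x]`.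
-/
lemma supLoc_le_iff (h : UpperSemicontinuous fun t => X t ω) (hax : a ≤ x) (hxb : x ≤ b) :
    supLoc X a b ω ≤ x ↔ supOn X x b ω ≤ supOn X a x ω := by
  have hl := isLeftmostMax_supLoc h (hax.trans hxb)
  constructor
  · intro hle
    refine (supOn_le_iff h hxb).2 fun t ht => ?_
    exact (hl.2.2 t ⟨hle.trans ht.1, ht.2⟩).trans (le_supOn h ⟨hl.1.1, hle⟩)
  · intro hle
    by_contra! hlt
    obtain ⟨t, ht, e⟩ := exists_eq_supOn h hax
    have h1 := hl.2.1 t ⟨ht.1, ht.2.trans_lt hlt⟩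
    have h2 := le_supOn h (a := x) (b := b) ⟨hlt.le, hl.1.2⟩
    linarith

end SupLocation

end

noncomputable section

namespace SupLocation

variable {Ω : Type*} [MeasurableSpace Ω] {P : Measure Ω} {X : ℝ → Ω → ℝ} {a b c x h : ℝ}

/-! ### Measurability and stationarity of suprema and of their locations -/

/-- `S` is a separating set of times for the suprema of the process. -/
def IsSeparating (X : ℝ → Ω → ℝ) (P : Measure Ω) (S : Set ℝ) : Prop :=
  ∀ᵐ ω ∂P, ∀ U : Set ℝ, IsOpen U → ∀ t ∈ U, ∀ c < X t ω, ∃ s ∈ U ∩ S, c < X s ω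

/-- Separability speaks of open sets only, so the end points have to be put into `K` by hand. The
exceptional null set does not depend on `a`, `b` or `K`. -/
lemma IsSeparating.ae_isLUB {S : Set ℝ} (hS : IsSeparating X P S) (husc : SampleUSC X) :
    ∀ᵐ ω ∂P, ∀ a b : ℝ, a ≤ b → ∀ K ⊆ Icc a b, S ∩ Ioo a b ⊆ K → a ∈ K → b ∈ K →
      IsLUB ((fun s => X s ω) '' K) (supOn X a b ω) := by
  filter_upwards [hS] with ω hω a b hab K hK hSK ha hb
  constructor
  · rintro _ ⟨s, hs, rfl⟩
    exact le_supOn (husc ω) (hK hs)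
  · intro c hc
    refine (supOn_le_iff (husc ω) hab).2 fun t ht => ?_
    by_contra! hlt
    rcases eq_or_lt_of_le ht.1 with rfl | hat
    · exact absurd (hc (mem_image_of_mem _ ha)) (not_le.2 hlt)
    rcases eq_or_lt_of_le ht.2 with rfl | htb
    · exact absurd (hc (mem_image_of_mem _ hb)) (not_le.2 hlt)
    obtain ⟨s, hs, hcs⟩ := hω (Ioo a b) isOpen_Ioo t ⟨hat, htb⟩ c hlt
    exact absurd (hc (mem_image_of_mem _ (hSK ⟨hs.2, hs.1⟩))) (not_le.2 hcs)

lemma measurable_path (hmeas : ∀ t, Measurable (X t)) (h : ℝ) :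
    Measurable fun ω t => X (t + h) ω :=
  measurable_pi_lambda _ fun _ => hmeas _

/-- Finite-dimensional laws determine a law on the product σ-algebra. Keeping `t + 0` gives both
sides the same shape. -/
lemma map_path_shift [IsProbabilityMeasure P] (hmeas : ∀ t, Measurable (X t))
    (hstat : IsStationary X P) (h : ℝ) :
    P.map (fun ω t => X (t + h) ω) = P.map (fun ω t => X (t + 0) ω) := by
  rw [map_eq_iff_forall_finset_map_restrict_eq (X := fun t ω => X (t + h) ω)
    (Y := fun t ω => X (t + 0) ω) (measurable_path hmeas h).aemeasurable
    (measurable_path hmeas 0).aemeasurable]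
  intro I
  have key := hstat I.card (fun i => (I.equivFin.symm i : ℝ)) h
  have hm : Measurable fun (z : Fin I.card → ℝ) (i : I) => z (I.equivFin i) := by fun_prop
  have h1 := congrArg (Measure.map fun (z : Fin I.card → ℝ) (i : I) => z (I.equivFin i)) key
  rw [Measure.map_map hm (measurable_pi_lambda _ fun _ => hmeas _),
    Measure.map_map hm (measurable_pi_lambda _ fun _ => hmeas _)] at h1
  convert! h1 using 2
  · ext ω i; simp
  · ext ω i; simp

lemma measure_path_shift [IsProbabilityMeasure P] (hmeas : ∀ t, Measurable (X t))
    (hstat : IsStationary X P) (h : ℝ) {E : Set (ℝ → ℝ)} (hE : MeasurableSet E) :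
    P {ω | (fun t => X (t + h) ω) ∈ E} = P {ω | (fun t => X t ω) ∈ E} := by
  have := congrArg (fun μ => μ E) (map_path_shift hmeas hstat h)
  simp only [Measure.map_apply (measurable_path hmeas h) hE,
    Measure.map_apply (measurable_path hmeas 0) hE] at this
  simp only [add_zero] at this
  exact this

lemma measureReal_path_shift [IsProbabilityMeasure P] (hmeas : ∀ t, Measurable (X t))
    (hstat : IsStationary X P) (h : ℝ) {E : Set (ℝ → ℝ)} (hE : MeasurableSet E) :
    P.real {ω | (fun t => X (t + h) ω) ∈ E} = P.real {ω | (fun t => X t ω) ∈ E} := by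
  rw [measureReal_def, measure_path_shift hmeas hstat h hE, measureReal_def]

/-- The supremum of a path over a set of times. -/
def pathSup (K : Set ℝ) (z : ℝ → ℝ) : ℝ := ⨆ s : K, z s

lemma measurable_pathSup {K : Set ℝ} (hK : K.Countable) : Measurable (pathSup K) := by
  have := hK.to_subtype
  exact Measurable.iSup fun s => measurable_pi_apply _

/-- A countable set of times that determines the suprema over `[a, b]` and over
`[a + h, b + h]` (after a shift). -/
def windowSet (S : Set ℝ) (h a b : ℝ) : Set ℝ :=
  ((S ∪ (fun s => s + h) ⁻¹' S) ∩ Icc a b) ∪ {a, b}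

lemma countable_windowSet {S : Set ℝ} (hS : S.Countable) (h a b : ℝ) :
    (windowSet S h a b).Countable :=
  ((hS.union (hS.preimage (add_left_injective h))).mono inter_subset_left).union (by simp)

lemma windowSet_subset {S : Set ℝ} (hab : a ≤ b) : windowSet S h a b ⊆ Icc a b :=
  union_subset inter_subset_right (by rintro _ (rfl | rfl) <;> simp [hab])

/-- One measurable functional of the path serves both windows, because `windowSet` also contains the
separating times pulled back by `h`. Stationarity of the path law then transfers to suprema. -/
lemma IsSeparating.ae_supOn_eq {S : Set ℝ} (hS : IsSeparating X P S) (husc : SampleUSC X)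
    (h : ℝ) : ∀ᵐ ω ∂P, ∀ a b : ℝ, a ≤ b →
      supOn X a b ω = pathSup (windowSet S h a b) (fun t => X t ω) ∧
      supOn X (a + h) (b + h) ω = pathSup (windowSet S h a b) (fun t => X (t + h) ω) := by
  filter_upwards [hS.ae_isLUB husc] with ω hω a b hab
  have hKs : windowSet S h a b ⊆ Icc a b := windowSet_subset hab
  have ha : a ∈ windowSet S h a b := Or.inr (by simp)
  have hb : b ∈ windowSet S h a b := Or.inr (by simp)
  have : Nonempty (windowSet S h a b) := ⟨⟨a, ha⟩⟩
  constructor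
  · refine (IsLUB.ciSup_eq ?_).symm
    have := hω a b hab _ hKs (fun s hs => Or.inl ⟨Or.inl hs.1, Ioo_subset_Icc_self hs.2⟩) ha hb
    rwa [image_eq_range] at this
  · refine (IsLUB.ciSup_eq ?_).symm
    have := hω (a + h) (b + h) (by linarith) ((fun s => s + h) '' windowSet S h a b)
      (by rintro _ ⟨s, hs, rfl⟩; exact ⟨by linarith [(hKs hs).1], by linarith [(hKs hs).2]⟩)
      (by
        intro s hs
        refine ⟨s - h, Or.inl ⟨Or.inr (by simpa using hs.1), ?_⟩, by simp⟩
        exact ⟨by linarith [hs.2.1], by linarith [hs.2.2]⟩)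
      ⟨a, ha, rfl⟩ ⟨b, hb, rfl⟩
    rwa [image_image, image_eq_range] at this

lemma aemeasurable_supOn (hmeas : ∀ t, Measurable (X t)) (husc : SampleUSC X)
    (hsep : IsSupSeparable X P) (hab : a ≤ b) : AEMeasurable (supOn X a b) P := by
  obtain ⟨S, hSc, hS⟩ := hsep
  refine ⟨fun ω => pathSup (windowSet S 0 a b) (fun t => X t ω),
    (measurable_pathSup (countable_windowSet hSc 0 a b)).comp
      (measurable_pi_lambda _ fun t => hmeas t), ?_⟩
  filter_upwards [IsSeparating.ae_supOn_eq hS husc 0] with ω hω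
  exact (hω a b hab).1

lemma measure_supOn_mem_shift [IsProbabilityMeasure P] (hmeas : ∀ t, Measurable (X t))
    (husc : SampleUSC X) (hsep : IsSupSeparable X P) (hstat : IsStationary X P) (hab : a ≤ b)
    (h : ℝ) {A : Set ℝ} (hA : MeasurableSet A) :
    P {ω | supOn X (a + h) (b + h) ω ∈ A} = P {ω | supOn X a b ω ∈ A} := by
  obtain ⟨S, hSc, hS⟩ := hsep
  have hm := measurable_pathSup (countable_windowSet hSc h a b)
  have key := measure_path_shift hmeas hstat h (hm hA)
  have hae := IsSeparating.ae_supOn_eq hS husc h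
  rw [measure_congr (s := {ω | supOn X (a + h) (b + h) ω ∈ A})
    (t := {ω | (fun t => X (t + h) ω) ∈ pathSup (windowSet S h a b) ⁻¹' A}), key]
  · refine measure_congr ?_
    filter_upwards [hae] with ω hω
    exact propext (by
      change pathSup _ _ ∈ A ↔ supOn X a b ω ∈ A
      rw [(hω a b hab).1])
  · filter_upwards [hae] with ω hω
    exact propext (by
      change supOn X (a + h) (b + h) ω ∈ A ↔ pathSup _ _ ∈ A
      rw [(hω a b hab).2])

lemma measure_supOn_le_supOn_shift [IsProbabilityMeasure P] (hmeas : ∀ t, Measurable (X t))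
    (husc : SampleUSC X) (hsep : IsSupSeparable X P) (hstat : IsStationary X P) {a' b' : ℝ}
    (hab : a ≤ b) (hab' : a' ≤ b') (h : ℝ) :
    P {ω | supOn X (a + h) (b + h) ω ≤ supOn X (a' + h) (b' + h) ω} =
      P {ω | supOn X a b ω ≤ supOn X a' b' ω} := by
  obtain ⟨S, hSc, hS⟩ := hsep
  have hE := measurableSet_le (measurable_pathSup (countable_windowSet hSc h a b))
    (measurable_pathSup (countable_windowSet hSc h a' b'))
  have key := measure_path_shift hmeas hstat h hE
  have hae := IsSeparating.ae_supOn_eq hS husc h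
  refine Eq.trans (measure_congr ?_) (key.trans (measure_congr ?_))
  · filter_upwards [hae] with ω hω
    exact propext (by
      change supOn X (a + h) (b + h) ω ≤ supOn X (a' + h) (b' + h) ω ↔ pathSup _ _ ≤ pathSup _ _
      rw [(hω a b hab).2, (hω a' b' hab').2])
  · filter_upwards [hae] with ω hω
    exact propext (by
      change pathSup _ _ ≤ pathSup _ _ ↔ supOn X a b ω ≤ supOn X a' b' ω
      rw [(hω a b hab).1, (hω a' b' hab').1])

lemma nullMeasurableSet_supLoc_le (hmeas : ∀ t, Measurable (X t)) (husc : SampleUSC X)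
    (hsep : IsSupSeparable X P) (hab : a ≤ b) (x : ℝ) :
    NullMeasurableSet {ω | supLoc X a b ω ≤ x} P := by
  rcases lt_or_ge x a with hxa | hax
  · have : {ω | supLoc X a b ω ≤ x} = ∅ := by
      ext ω
      simpa using hxa.trans_le (supLoc_mem_Icc (husc ω) hab).1
    rw [this]; exact nullMeasurableSet_empty
  rcases le_or_gt b x with hbx | hxb
  · have : {ω | supLoc X a b ω ≤ x} = univ := by
      ext ω
      simpa using (supLoc_mem_Icc (husc ω) hab).2.trans hbx
    rw [this]; exact nullMeasurableSet_univ
  · have : {ω | supLoc X a b ω ≤ x} = {ω | supOn X x b ω ≤ supOn X a x ω} := by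
      ext ω
      exact supLoc_le_iff (husc ω) hax hxb.le
    rw [this]
    exact nullMeasurableSet_le (aemeasurable_supOn hmeas husc hsep hxb.le)
      (aemeasurable_supOn hmeas husc hsep hax)

lemma aemeasurable_supLoc [IsProbabilityMeasure P] (hmeas : ∀ t, Measurable (X t))
    (husc : SampleUSC X) (hsep : IsSupSeparable X P) (hab : a ≤ b) :
    AEMeasurable (supLoc X a b) P := by
  refine NullMeasurable.aemeasurable ?_
  refine @measurable_of_Iic ℝ (NullMeasurableSpace Ω P) _ _ _ _ _ _ _ _ fun x => ?_
  exact nullMeasurableSet_supLoc_le hmeas husc hsep hab x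

lemma map_supLoc_shift [IsProbabilityMeasure P] (hmeas : ∀ t, Measurable (X t))
    (husc : SampleUSC X) (hsep : IsSupSeparable X P) (hstat : IsStationary X P) (hab : a ≤ b)
    (h : ℝ) :
    P.map (fun ω => supLoc X (a + h) (b + h) ω - h) = P.map (supLoc X a b) := by
  have hm1 := (aemeasurable_supLoc hmeas husc hsep
    (show a + h ≤ b + h by linarith)).sub_const h
  have hm2 := aemeasurable_supLoc hmeas husc hsep hab
  have := Measure.isProbabilityMeasure_map hm1
  have := Measure.isProbabilityMeasure_map hm2
  refine Measure.ext_of_Iic _ _ fun x => ?_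
  rw [Measure.map_apply_of_aemeasurable hm1 measurableSet_Iic,
    Measure.map_apply_of_aemeasurable hm2 measurableSet_Iic]
  have hpre : ∀ ω, supLoc X (a + h) (b + h) ω ∈ Icc (a + h) (b + h) := fun ω =>
    supLoc_mem_Icc (husc ω) (by linarith)
  have hpre' : ∀ ω, supLoc X a b ω ∈ Icc a b := fun ω => supLoc_mem_Icc (husc ω) hab
  rcases lt_or_ge x a with hxa | hax
  · congr 1; ext ω
    simp only [mem_preimage, mem_Iic]
    constructor <;> intro hx <;> linarith [(hpre ω).1, (hpre' ω).1]
  rcases le_or_gt b x with hbx | hxb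
  · congr 1; ext ω
    simp only [mem_preimage, mem_Iic]
    constructor <;> intro hx <;> linarith [(hpre ω).2, (hpre' ω).2]
  · have := measure_supOn_le_supOn_shift hmeas husc hsep hstat hxb.le hax h
    convert! this using 2
    · ext ω
      simp only [mem_preimage, mem_Iic, mem_ofPred_eq, sub_le_iff_le_add]
      exact supLoc_le_iff (husc ω) (by linarith) (by linarith)
    · ext ω
      exact supLoc_le_iff (husc ω) hax hxb.le

end SupLocation

end

noncomputable section

namespace SupLocation

variable {Ω : Type*} [MeasurableSpace Ω] {P : Measure Ω} {X : ℝ → Ω → ℝ} {a b c x h : ℝ}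

/-! ### Families of location laws -/

/-- The inequalities satisfied by the laws `ρ T` of the location of the supremum over `[0, T]`
of a stationary process. The quantity `(ρ (a + b)).real (Ioc a (a + e))` is the probability
that the location over `[-a, b]` falls in `(0, e]`. -/
structure IsLocFamily (ρ : ℝ → Measure ℝ) : Prop where
  prob : ∀ T, 0 < T → IsProbabilityMeasure (ρ T)
  supp : ∀ T, 0 < T → ρ T (Icc 0 T)ᶜ = 0
  anti : ∀ a a' b b' e, 0 ≤ a → a ≤ a' → 0 < b → b ≤ b' → e ≤ b →
    (ρ (a' + b')).real (Ioc a' (a' + e)) ≤ (ρ (a + b)).real (Ioc a (a + e))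
  supermod : ∀ a a' b b' e, 0 ≤ a → a ≤ a' → 0 < b → b ≤ b' → e ≤ b →
    (ρ (a + b')).real (Ioc a (a + e)) - (ρ (a' + b')).real (Ioc a' (a' + e)) ≤
      (ρ (a + b)).real (Ioc a (a + e)) - (ρ (a' + b)).real (Ioc a' (a' + e))

/-- Recentring the window at `a` puts all the cells to be compared at the same place `(0, e]`, so
that events for different windows can be compared path by path. -/
lemma real_map_supLoc [IsProbabilityMeasure P] (hmeas : ∀ t, Measurable (X t))
    (husc : SampleUSC X) (hsep : IsSupSeparable X P) (hstat : IsStationary X P)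
    (ha : 0 ≤ a) (hb : 0 ≤ b) (e : ℝ) :
    (P.map (supLoc X 0 (a + b))).real (Ioc a (a + e)) =
      P.real {ω | supLoc X (-a) b ω ∈ Ioc 0 e} := by
  have key := map_supLoc_shift hmeas husc hsep hstat (show -a ≤ b by linarith) a
  rw [neg_add_cancel, add_comm b a] at key
  have hm := aemeasurable_supLoc hmeas husc hsep (show 0 ≤ a + b by linarith)
  have hm2 := aemeasurable_supLoc hmeas husc hsep (show -a ≤ b by linarith)
  have h1 := congrArg (fun μ => μ.real (Ioc 0 e)) key
  simp only [measureReal_def, Measure.map_apply_of_aemeasurable (hm.sub_const a) measurableSet_Ioc,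
    Measure.map_apply_of_aemeasurable hm2 measurableSet_Ioc] at h1
  simp only [measureReal_def, Measure.map_apply_of_aemeasurable hm measurableSet_Ioc]
  have : (supLoc X 0 (a + b)) ⁻¹' Ioc a (a + e) =
      (fun ω => supLoc X 0 (a + b) ω - a) ⁻¹' Ioc 0 e := by
    ext ω
    simp [add_comm]
  rw [this]
  exact h1

lemma isLocFamily_map_supLoc [IsProbabilityMeasure P] (hmeas : ∀ t, Measurable (X t))
    (husc : SampleUSC X) (hsep : IsSupSeparable X P) (hstat : IsStationary X P) :
    IsLocFamily fun T => P.map (supLoc X 0 T) where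
  prob T hT := Measure.isProbabilityMeasure_map (aemeasurable_supLoc hmeas husc hsep hT.le)
  supp T hT := by
    rw [Measure.map_apply_of_aemeasurable (aemeasurable_supLoc hmeas husc hsep hT.le)
      measurableSet_Icc.compl]
    convert measure_empty (μ := P)
    ext ω
    simpa using supLoc_mem_Icc (husc ω) hT.le
  anti a a' b b' e ha haa' hb hbb' heb := by
    rw [real_map_supLoc hmeas husc hsep hstat (ha.trans haa') (hb.le.trans hbb'),
      real_map_supLoc hmeas husc hsep hstat ha hb.le]
    refine measureReal_mono fun ω hω => ?_
    have := supLoc_eq_of_subset (husc ω) (show -a ≤ b by linarith) (neg_le_neg haa') hbb'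
      ⟨by linarith [hω.1], hω.2.trans heb⟩
    simpa only [mem_ofPred_eq, this] using hω
  supermod a a' b b' e ha haa' hb hbb' heb := by
    have hnm : ∀ a b, 0 ≤ a → 0 < b →
        NullMeasurableSet {ω | supLoc X (-a) b ω ∈ Ioc 0 e} P := fun a b ha hb =>
      (aemeasurable_supLoc hmeas husc hsep (show -a ≤ b by linarith)).nullMeasurable
        measurableSet_Ioc
    have ha' := ha.trans haa'
    have hb' := hb.trans_le hbb'
    rw [real_map_supLoc hmeas husc hsep hstat ha hb'.le,
      real_map_supLoc hmeas husc hsep hstat ha' hb'.le,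
      real_map_supLoc hmeas husc hsep hstat ha hb.le,
      real_map_supLoc hmeas husc hsep hstat ha' hb.le]
    have key : ∀ {a a' b b' : ℝ}, 0 ≤ a → a ≤ a' → 0 < b → b ≤ b' → e ≤ b →
        {ω | supLoc X (-a') b' ω ∈ Ioc 0 e} ⊆ {ω | supLoc X (-a) b ω ∈ Ioc 0 e} := by
      intro a a' b b' ha haa' hb hbb' heb ω hω
      have := supLoc_eq_of_subset (husc ω) (show -a ≤ b by linarith) (neg_le_neg haa') hbb'
        ⟨by linarith [hω.1], hω.2.trans heb⟩
      simpa only [mem_ofPred_eq, this] using hω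
    have hd : ∀ b, 0 < b → e ≤ b → P.real {ω | supLoc X (-a) b ω ∈ Ioc 0 e} -
        P.real {ω | supLoc X (-a') b ω ∈ Ioc 0 e} =
        P.real ({ω | supLoc X (-a) b ω ∈ Ioc 0 e} \ {ω | supLoc X (-a') b ω ∈ Ioc 0 e}) := by
      intro b hb heb
      have := measureReal_inter_add_sdiff₀
        (s := {ω | supLoc X (-a) b ω ∈ Ioc 0 e}) (hnm a' b ha' hb)
      rw [inter_eq_self_of_subset_right (key ha haa' hb le_rfl heb)] at this
      linarith
    rw [hd b' hb' (heb.trans hbb'), hd b hb heb]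
    -- Were the location over `[-a', b]` also in `(0, e]`, it would coincide with the one over `[-a,
    -- b']`, and the common point would be the location over the union `[-a', b']`, contrary to
    -- `h2`.
    refine measureReal_mono fun ω ⟨h1, h2⟩ => ⟨key ha le_rfl hb hbb' heb h1, fun h3 => h2 ?_⟩
    have e1 := supLoc_eq_of_subset (husc ω) (show -a ≤ b by linarith) le_rfl hbb'
        ⟨by linarith [h1.1], h1.2.trans heb⟩
    have e2 := supLoc_eq_of_subset (husc ω) (show -a ≤ b by linarith) (neg_le_neg haa') le_rfl
        ⟨by linarith [h3.1], h3.2.trans heb⟩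
    have := supLoc_eq_of_eq_of_eq (husc ω) (show -a ≤ b' by linarith) (show -a' ≤ b by linarith)
      (neg_le_neg haa') rfl (e2.symm.trans e1)
    simpa only [mem_ofPred_eq, this] using h1

end SupLocation

end

noncomputable section

namespace SupLocation

/-! ### Increments of the location laws -/

lemma real_Ioc_add_mul (μ : Measure ℝ) [IsFiniteMeasure μ] (c : ℝ) {e : ℝ} (he : 0 ≤ e) (N : ℕ) :
    μ.real (Ioc c (c + N * e)) =
      ∑ i ∈ Finset.range N, μ.real (Ioc (c + i * e) (c + i * e + e)) := by
  induction N with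
  | zero => simp
  | succ N ih =>
    have hN : 0 ≤ N * e := by positivity
    rw [Finset.sum_range_succ, ← ih, ← measureReal_union _ measurableSet_Ioc,
      Ioc_union_Ioc_eq_Ioc (by linarith) (by linarith)]
    · push_cast; congr 2; ring
    · rw [disjoint_left]
      rintro z hz hz'
      exact absurd hz.2 (not_le.2 hz'.1)

variable {ρ : ℝ → Measure ℝ} {T y Δ e a b : ℝ}

/-- Cut `(y - Δ, y]` into `N` cells. Seen from each of them, the window of length `T - Δ` reaches no
further to either side than the window of length `T` seen from `y`, so `anti` bounds every cell from
below by the same quantity. -/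
lemma IsLocFamily.mul_real_le (hρ : IsLocFamily ρ) (hΔ : 0 < Δ) (hy : Δ ≤ y) (hyT : y + Δ ≤ T)
    {N : ℕ} (hN : 0 < N) :
    N * (ρ T).real (Ioc y (y + Δ / N)) ≤ (ρ (T - Δ)).real (Ioc (y - Δ) y) := by
  have hN' : (0 : ℝ) < N := by exact_mod_cast hN
  have hT : 0 < T - Δ := by linarith
  have := hρ.prob _ hT
  have hsum := real_Ioc_add_mul (ρ (T - Δ)) (y - Δ) (show 0 ≤ Δ / N by positivity) N
  rw [mul_div_cancel₀ _ hN'.ne', sub_add_cancel] at hsum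
  rw [hsum]
  refine le_trans (b := ∑ i ∈ Finset.range N, (ρ T).real (Ioc y (y + Δ / N))) (by simp)
    (Finset.sum_le_sum fun i hi => ?_)
  have hi' : (i : ℝ) + 1 ≤ N := by exact_mod_cast Finset.mem_range.1 hi
  have hile : (i + 1) * (Δ / N) ≤ Δ := by
    calc (i + 1) * (Δ / N) ≤ N * (Δ / N) := by gcongr
      _ = Δ := mul_div_cancel₀ _ hN'.ne'
  have he : 0 < Δ / N := by positivity
  have hi0 : 0 ≤ (i : ℝ) * (Δ / N) := by positivity
  have h := hρ.anti (y - Δ + i * (Δ / N)) y (T - y - i * (Δ / N)) (T - y) (Δ / N)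
    (by linarith) (by linarith) (by linarith) (by linarith) (by linarith)
  rw [show y + (T - y) = T by ring,
    show y - Δ + i * (Δ / N) + (T - y - i * (Δ / N)) = T - Δ by ring] at h
  exact h

/-- The mirror argument: seen from a cell of `(y, y + Δ]`, the window of length `T + Δ` reaches at
least as far to both sides as the window of length `T` seen from `y`. -/
lemma IsLocFamily.le_mul_real (hρ : IsLocFamily ρ) (hΔ : 0 < Δ) (hy : 0 ≤ y) (hyT : y < T)
    {N : ℕ} (hN : 0 < N) (hNT : Δ / N ≤ T - y) :
    (ρ (T + Δ)).real (Ioc y (y + Δ)) ≤ N * (ρ T).real (Ioc y (y + Δ / N)) := by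
  have hN' : (0 : ℝ) < N := by exact_mod_cast hN
  have hT : 0 < T + Δ := by linarith
  have := hρ.prob _ hT
  have hsum := real_Ioc_add_mul (ρ (T + Δ)) y (show 0 ≤ Δ / N by positivity) N
  rw [mul_div_cancel₀ _ hN'.ne'] at hsum
  rw [hsum]
  refine le_trans (b := ∑ i ∈ Finset.range N, (ρ T).real (Ioc y (y + Δ / N)))
    (Finset.sum_le_sum fun i hi => ?_) (by simp)
  have hi' : (i : ℝ) + 1 ≤ N := by exact_mod_cast Finset.mem_range.1 hi
  have he : 0 < Δ / N := by positivity
  have hile : (i + 1) * (Δ / N) ≤ Δ := by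
    calc (i + 1) * (Δ / N) ≤ N * (Δ / N) := by gcongr
      _ = Δ := mul_div_cancel₀ _ hN'.ne'
  have hi0 : 0 ≤ (i : ℝ) * (Δ / N) := by positivity
  have h := hρ.anti y (y + i * (Δ / N)) (T - y) (T + Δ - y - i * (Δ / N)) (Δ / N)
    hy (by linarith) (by linarith) (by linarith) hNT
  rw [show y + (T - y) = T by ring,
    show y + i * (Δ / N) + (T + Δ - y - i * (Δ / N)) = T + Δ by ring] at h
  exact h

lemma IsLocFamily.real_Ioc_le (hρ : IsLocFamily ρ) (hΔ : 0 < Δ) (hy : Δ ≤ y) (hyT : y + Δ ≤ T)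
    (he : 0 ≤ e) : (ρ T).real (Ioc y (y + e)) ≤ 2 / Δ * e := by
  have := hρ.prob T (by linarith)
  have := hρ.prob (T - Δ) (by linarith)
  rcases he.eq_or_lt with rfl | he
  · simp
  rcases lt_or_ge Δ e with hlt | hle
  · have : 1 ≤ 2 / Δ * e := by
      rw [div_mul_eq_mul_div, le_div_iff₀ hΔ]; linarith
    exact measureReal_le_one.trans this
  have h1 : 1 ≤ Δ / e := by rwa [le_div_iff₀ he, one_mul]
  -- At least `N` cells of length `e` fit into `Δ`, so one of them has mass at most `1 / N`. The
  -- factor `2` in the bound pays for rounding down.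
  have hN : 0 < ⌊Δ / e⌋₊ := Nat.floor_pos.2 h1
  set N := ⌊Δ / e⌋₊
  have hN' : (1 : ℝ) ≤ N := by exact_mod_cast hN
  have hNle : (N : ℝ) ≤ Δ / e := Nat.floor_le (by positivity)
  have hNlt : Δ / e < N + 1 := Nat.lt_floor_add_one _
  have heN : e ≤ Δ / N := by
    rw [le_div_iff₀ (by linarith)]
    rw [le_div_iff₀ he] at hNle
    linarith
  have key := (hρ.mul_real_le hΔ hy hyT hN).trans measureReal_le_one
  have hmono : (ρ T).real (Ioc y (y + e)) ≤ (ρ T).real (Ioc y (y + Δ / N)) :=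
    measureReal_mono (Ioc_subset_Ioc_right (by linarith))
  refine hmono.trans ?_
  rw [div_lt_iff₀ he] at hNlt
  rw [div_mul_eq_mul_div, le_div_iff₀ hΔ]
  have h0 : 0 ≤ (ρ T).real (Ioc y (y + Δ / N)) := measureReal_nonneg
  have : Δ ≤ 2 * N * e := by nlinarith
  nlinarith

/-- The difference quotients are bounded, so along one fixed ultrafilter they converge for all `a`,
`b` simultaneously. Inequalities between them then pass to `q` without knowing that ordinary limits
exist. -/
lemma IsLocFamily.exists_intensity (hρ : IsLocFamily ρ) :
    ∃ (U : Ultrafilter ℝ) (q : ℝ → ℝ → ℝ), ↑U ≤ 𝓝[>] (0 : ℝ) ∧ ∀ a b, 0 < a → 0 < b →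
      Tendsto (fun e => (ρ (a + b)).real (Ioc a (a + e)) / e) U (𝓝 (q a b)) := by
  refine ⟨Ultrafilter.of (𝓝[>] 0), ?_⟩
  have hU := Ultrafilter.of_le (𝓝[>] (0 : ℝ))
  have : ∀ a b, ∃ l, 0 < a → 0 < b → Tendsto (fun e => (ρ (a + b)).real (Ioc a (a + e)) / e)
      (Ultrafilter.of (𝓝[>] (0 : ℝ))) (𝓝 l) := by
    intro a b
    by_cases hab : 0 < a ∧ 0 < b
    · have hmin : 0 < min a b := lt_min hab.1 hab.2
      have hmem : ∀ᶠ e in Ultrafilter.of (𝓝[>] (0 : ℝ)),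
          (ρ (a + b)).real (Ioc a (a + e)) / e ∈ Icc 0 (2 / min a b) := by
        refine hU ?_
        filter_upwards [self_mem_nhdsWithin] with e he
        have he' : 0 < e := he
        refine ⟨by positivity, ?_⟩
        rw [div_le_iff₀ he']
        exact hρ.real_Ioc_le hmin (min_le_left _ _) (by linarith [min_le_right a b]) he'.le
      obtain ⟨l, -, hl⟩ := isCompact_Icc.ultrafilter_le_nhds
        ((Ultrafilter.of (𝓝[>] (0 : ℝ))).map fun e => (ρ (a + b)).real (Ioc a (a + e)) / e)
        (le_principal_iff.2 hmem)
      exact ⟨l, fun _ _ => hl⟩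
    · exact ⟨0, fun h1 h2 => absurd ⟨h1, h2⟩ hab⟩
  choose q hq using this
  exact ⟨q, hU, hq⟩

/-! ### Functions with increments dominated by those of a monotone function -/

lemma exists_tendsto_of_monotoneOn {f : ℝ → ℝ} {c d t : ℝ} (hf : MonotoneOn f (Ioo c d))
    (ht : t ∈ Ioo c d) :
    (∃ l, Tendsto f (𝓝[<] t) (𝓝 l)) ∧ ∃ l, Tendsto f (𝓝[>] t) (𝓝 l) := by
  constructor
  · refine ⟨_, MonotoneOn.tendsto_nhdsWithin_Ioo_left (nonempty_Ioo.2 ht.1)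
      (hf.mono (Ioo_subset_Ioo_right ht.2.le)) ⟨f t, ?_⟩⟩
    rintro _ ⟨s, hs, rfl⟩
    exact hf ⟨hs.1, hs.2.trans ht.2⟩ ht hs.2.le
  · refine ⟨_, MonotoneOn.tendsto_nhdsWithin_Ioo_right (nonempty_Ioo.2 ht.2)
      (hf.mono (Ioo_subset_Ioo_left ht.1.le)) ⟨f t, ?_⟩⟩
    rintro _ ⟨s, hs, rfl⟩
    exact hf ht ⟨ht.1.trans hs.1, hs.2⟩ hs.1.le

section Dominated

variable {f w : ℝ → ℝ} {c d t : ℝ}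

/-- The Jordan decomposition: `w + f` and `w - f` are both monotone. -/
lemma exists_monotoneOn_sub_eq
    (h : ∀ s ∈ Ioo c d, ∀ t ∈ Ioo c d, s ≤ t → |f s - f t| ≤ w t - w s) :
    ∃ g k : ℝ → ℝ, MonotoneOn g (Ioo c d) ∧ MonotoneOn k (Ioo c d) ∧ f = g - k := by
  refine ⟨fun t => (w t + f t) / 2, fun t => (w t - f t) / 2, fun s hs t ht hst => ?_,
    fun s hs t ht hst => ?_, ?_⟩
  · have := abs_le.1 (h s hs t ht hst)
    change (w s + f s) / 2 ≤ (w t + f t) / 2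
    linarith [this.1, this.2]
  · have := abs_le.1 (h s hs t ht hst)
    change (w s - f s) / 2 ≤ (w t - f t) / 2
    linarith [this.1, this.2]
  · ext t
    simp only [Pi.sub_apply]
    ring

lemma exists_tendsto_of_dominated
    (h : ∀ s ∈ Ioo c d, ∀ t ∈ Ioo c d, s ≤ t → |f s - f t| ≤ w t - w s) (ht : t ∈ Ioo c d) :
    (∃ l, Tendsto f (𝓝[<] t) (𝓝 l)) ∧ ∃ l, Tendsto f (𝓝[>] t) (𝓝 l) := by
  obtain ⟨g, k, hg, hk, rfl⟩ := exists_monotoneOn_sub_eq h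
  obtain ⟨⟨l₁, h₁⟩, r₁, h₁'⟩ := exists_tendsto_of_monotoneOn hg ht
  obtain ⟨⟨l₂, h₂⟩, r₂, h₂'⟩ := exists_tendsto_of_monotoneOn hk ht
  exact ⟨⟨_, h₁.sub h₂⟩, _, h₁'.sub h₂'⟩

lemma countable_rightLim_ne_of_dominated
    (h : ∀ s ∈ Ioo c d, ∀ t ∈ Ioo c d, s ≤ t → |f s - f t| ≤ w t - w s) :
    {t ∈ Ioo c d | Function.rightLim f t ≠ f t}.Countable := by
  obtain ⟨g, k, hg, hk, rfl⟩ := exists_monotoneOn_sub_eq h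
  refine (hg.countable_not_continuousWithinAt.union hk.countable_not_continuousWithinAt).mono ?_
  rintro t ⟨ht, hne⟩
  by_contra hcon
  simp only [mem_union, mem_ofPred_eq, not_or, not_and, not_not] at hcon
  have hc : ContinuousAt (g - k) t :=
    ((hcon.1 ht).sub (hcon.2 ht)).continuousAt (Ioo_mem_nhds ht.1 ht.2)
  exact hne hc.continuousWithinAt.rightLim_eq

end Dominated

/-! ### Absolute continuity of the location laws -/

/-- The distribution function is Lipschitz on `[c, d]`, hence the integral of its derivative, which
is a.e. `μ.rnDeriv volume`. The absolutely continuous part thus already carries all the mass of `(c,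
d]`. -/
lemma singularPart_Ioc_eq_zero {μ : Measure ℝ} [IsProbabilityMeasure μ] {c d : ℝ} (hcd : c ≤ d)
    {K : ℝ} (hK : ∀ s ∈ Icc c d, ∀ t ∈ Icc c d, s ≤ t → μ.real (Ioc s t) ≤ K * (t - s)) :
    μ.singularPart volume (Ioc c d) = 0 := by
  have hcdf : ∀ s t, s ≤ t → cdf μ t - cdf μ s = μ.real (Ioc s t) := by
    intro s t hst
    rw [cdf_eq_real, cdf_eq_real, ← Iic_union_Ioc_eq_Iic hst,
      measureReal_union _ measurableSet_Ioc]
    · ring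
    · rw [disjoint_left]
      exact fun z hz hz' => absurd hz (not_le.2 hz'.1)
  have hlip : LipschitzOnWith (Real.toNNReal K) (cdf μ) (uIcc c d) := by
    rw [uIcc_of_le hcd]
    refine LipschitzOnWith.of_le_add_mul _ fun x hx y hy => ?_
    rcases le_total x y with hxy | hyx
    · have := monotone_cdf μ hxy
      have : 0 ≤ (Real.toNNReal K : ℝ) * dist x y := by positivity
      linarith
    · have h1 := hK y hy x hx hyx
      rw [← hcdf y x hyx] at h1
      rw [Real.dist_eq, abs_of_nonneg (sub_nonneg.2 hyx)]
      have : K * (x - y) ≤ Real.toNNReal K * (x - y) :=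
        mul_le_mul_of_nonneg_right (Real.le_coe_toNNReal K) (sub_nonneg.2 hyx)
      linarith
  have hac := hlip.absolutelyContinuousOnInterval
  have hae := (cdf μ).ae_hasDerivAt
  rw [measure_cdf] at hae
  have hFTC := hac.integral_deriv_eq_sub
  rw [intervalIntegral.integral_of_le hcd, integral_congr_ae (g := fun x =>
    (μ.rnDeriv volume x).toReal) (ae_restrict_of_ae (hae.mono fun x hx => hx.deriv)),
    integral_toReal (Measure.measurable_rnDeriv _ _).aemeasurable
      (ae_restrict_of_ae (Measure.rnDeriv_lt_top _ _)), hcdf c d hcd, measureReal_def] at hFTC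
  have hfin : ∫⁻ x in Ioc c d, μ.rnDeriv volume x ≠ ⊤ :=
    ((Measure.setLIntegral_rnDeriv_le _).trans_lt (measure_lt_top _ _)).ne
  have heq := (ENNReal.toReal_eq_toReal_iff' hfin (measure_ne_top _ _)).1 hFTC
  have hdec := congrArg (fun ν => ν (Ioc c d)) (μ.haveLebesgueDecomposition_add volume)
  simp only [Measure.add_apply, withDensity_apply _ measurableSet_Ioc] at hdec
  rw [heq] at hdec
  have := ENNReal.eq_sub_of_add_eq (measure_ne_top _ _) hdec.symm
  rwa [tsub_self] at this

lemma restrict_eq_withDensity {μ : Measure ℝ} [IsProbabilityMeasure μ] {T : ℝ}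
    (hK : ∀ c d, 0 < c → d < T → ∃ K : ℝ, ∀ s ∈ Icc c d, ∀ t ∈ Icc c d, s ≤ t →
      μ.real (Ioc s t) ≤ K * (t - s)) :
    μ.restrict (Ioo 0 T) = (volume.restrict (Ioo 0 T)).withDensity (μ.rnDeriv volume) := by
  have hsing : μ.singularPart volume (Ioo 0 T) = 0 := by
    refine measure_null_of_locally_null _ fun x hx => ?_
    obtain ⟨c, hc0, hcx⟩ := exists_between hx.1
    obtain ⟨d, hxd, hdT⟩ := exists_between hx.2
    refine ⟨Ioc c d, mem_nhdsWithin_of_mem_nhds (Ioc_mem_nhds hcx hxd), ?_⟩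
    obtain ⟨K, hK⟩ := hK c d hc0 hdT
    exact singularPart_Ioc_eq_zero (hcx.trans hxd).le hK
  have hdec := congrArg (fun ν => ν.restrict (Ioo 0 T)) (μ.haveLebesgueDecomposition_add volume)
  simp only [Measure.restrict_add, Measure.restrict_eq_zero.2 hsing, zero_add,
    restrict_withDensity measurableSet_Ioo] at hdec
  exact hdec

/-- The law of the location has in `(0, T)` a density that is right continuous with left
limits. -/
theorem IsLocFamily.exists_density (hρ : IsLocFamily ρ) (hT : 0 < T) :
    ∃ f : ℝ → ℝ, (∀ t ∈ Ioo 0 T, 0 ≤ f t) ∧ (∀ t ∈ Ioo 0 T, ContinuousWithinAt f (Ici t) t) ∧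
      (∀ t ∈ Ioo 0 T, ∃ l : ℝ, Tendsto f (𝓝[<] t) (𝓝 l)) ∧
      (ρ T).restrict (Ioo 0 T) =
        (volume.restrict (Ioo 0 T)).withDensity fun t => ENNReal.ofReal (f t) := by
  have := hρ.prob T hT
  obtain ⟨U, q, hU, hq⟩ := hρ.exists_intensity
  have hpos : ∀ᶠ e in (U : Filter ℝ), 0 < e := hU self_mem_nhdsWithin
  have hlt : ∀ b, 0 < b → ∀ᶠ e in (U : Filter ℝ), e ≤ b := fun b hb =>
    hU (mem_nhdsWithin_of_mem_nhds (Iic_mem_nhds hb))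
  have hq0 : ∀ a b, 0 < a → 0 < b → 0 ≤ q a b := fun a b ha hb =>
    ge_of_tendsto (hq a b ha hb) (hpos.mono fun e he => by positivity)
  have hanti : ∀ a a' b b', 0 < a → a ≤ a' → 0 < b → b ≤ b' → q a' b' ≤ q a b := by
    intro a a' b b' ha haa' hb hbb'
    refine le_of_tendsto_of_tendsto (hq a' b' (by linarith) (by linarith)) (hq a b ha hb) ?_
    filter_upwards [hpos, hlt b hb] with e he heb
    exact div_le_div_of_nonneg_right (hρ.anti a a' b b' e ha.le haa' hb hbb' heb) he.le
  have hsuper : ∀ a a' b b', 0 < a → a ≤ a' → 0 < b → b ≤ b' →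
      q a b' - q a' b' ≤ q a b - q a' b := by
    intro a a' b b' ha haa' hb hbb'
    refine le_of_tendsto_of_tendsto
      ((hq a b' ha (by linarith)).sub (hq a' b' (by linarith) (by linarith)))
      ((hq a b ha hb).sub (hq a' b (by linarith) hb)) ?_
    filter_upwards [hpos, hlt b hb] with e he heb
    rw [← sub_div, ← sub_div]
    exact div_le_div_of_nonneg_right (hρ.supermod a a' b b' e ha.le haa' hb hbb' heb) he.le
  set f : ℝ → ℝ := fun t => q t (T - t) with hf
  -- Passing from `s` to `t` lengthens the left arm, which lowers `q`, and shortens the right arm,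
  -- which raises it. By `hsuper` each change is at most the same change with the other arm
  -- shortened to its least length, `c` on the left and `T - d` on the right.
  have hdom : ∀ c d, 0 < c → d < T → ∀ s ∈ Ioo c d, ∀ t ∈ Ioo c d, s ≤ t →
      |f s - f t| ≤ (q c (T - t) - q t (T - d)) - (q c (T - s) - q s (T - d)) := by
    intro c d hc hd s hs t ht hst
    have hcs := hs.1
    have htd := ht.2
    have h1 := hanti s s (T - t) (T - s) (by linarith) le_rfl (by linarith) (by linarith)
    have h2 := hsuper s t (T - d) (T - t) (by linarith) hst (by linarith) (by linarith)
    have h3 := hanti s t (T - t) (T - t) (by linarith) hst (by linarith) le_rfl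
    have h4 := hsuper c s (T - t) (T - s) hc (by linarith) (by linarith) (by linarith)
    have h5 := hanti c c (T - t) (T - s) hc le_rfl (by linarith) (by linarith)
    have h6 := hanti s t (T - d) (T - d) (by linarith) hst (by linarith) le_rfl
    rw [abs_le]
    constructor <;> simp only [hf] <;> linarith
  have hlim : ∀ t ∈ Ioo 0 T, (∃ l, Tendsto f (𝓝[<] t) (𝓝 l)) ∧ ∃ l, Tendsto f (𝓝[>] t) (𝓝 l) := by
    intro t ht
    obtain ⟨c, hc0, hcx⟩ := exists_between ht.1
    obtain ⟨d, hxd, hdT⟩ := exists_between ht.2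
    exact exists_tendsto_of_dominated (w := fun t => q c (T - t) - q t (T - d))
      (hdom c d hc0 hdT) ⟨hcx, hxd⟩
  have hr : ∀ t ∈ Ioo 0 T, Tendsto f (𝓝[>] t) (𝓝 (Function.rightLim f t)) := fun t ht =>
    tendsto_rightLim_of_tendsto (hlim t ht).2
  refine ⟨Function.rightLim f, fun t ht => ?_,
    fun t ht => continuousWithinAt_rightLim_Ici (hr t ht), fun t ht => ?_, ?_⟩
  · refine ge_of_tendsto (hr t ht) ?_
    filter_upwards [Ioo_mem_nhdsGT ht.2] with s hs
    exact hq0 _ _ (ht.1.trans hs.1) (by linarith [hs.2])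
  · obtain ⟨l, hl⟩ := (hlim t ht).1
    refine ⟨l, ?_⟩
    -- Right limits of values of `f` in a closed neighbourhood stay in it, so `rightLim f` inherits
    -- the left limit of `f`.
    refine (closed_nhds_basis l).tendsto_right_iff.2 ?_
    rintro V ⟨hV, hVc⟩
    have hev := (closed_nhds_basis l).tendsto_right_iff.1 hl V ⟨hV, hVc⟩
    obtain ⟨u, hut, hu⟩ := (mem_nhdsLT_iff_exists_Ioo_subset' ht.1).1 hev
    filter_upwards [Ioo_mem_nhdsLT (max_lt hut ht.1)] with s hs
    have hs1 := (le_max_left _ _).trans_lt hs.1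
    have hs2 := (le_max_right _ _).trans_lt hs.1
    refine hVc.mem_of_tendsto (hr s ⟨hs2, hs.2.trans ht.2⟩) ?_
    filter_upwards [Ioo_mem_nhdsGT hs.2] with z hz
    exact hu ⟨hs1.trans hz.1, hz.2⟩
  · rw [restrict_eq_withDensity]
    · refine withDensity_congr_ae ?_
      have hae := (cdf (ρ T)).ae_hasDerivAt
      rw [measure_cdf] at hae
      have hrl : ∀ᵐ t, t ∈ Ioo 0 T → Function.rightLim f t = f t := by
        rw [ae_iff]
        refine measure_null_of_locally_null _ fun x hx => ?_
        simp only [mem_ofPred_eq, Classical.not_imp] at hx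
        obtain ⟨c, hc0, hcx⟩ := exists_between hx.1.1
        obtain ⟨d, hxd, hdT⟩ := exists_between hx.1.2
        refine ⟨_, inter_mem self_mem_nhdsWithin
          (mem_nhdsWithin_of_mem_nhds (Ioo_mem_nhds hcx hxd)), ?_⟩
        refine measure_mono_null ?_ ((countable_rightLim_ne_of_dominated
          (w := fun t => q c (T - t) - q t (T - d)) (hdom c d hc0 hdT)).measure_zero _)
        rintro t ⟨ht, htcd⟩
        simp only [mem_ofPred_eq, Classical.not_imp] at ht
        exact ⟨htcd, ht.2⟩
      filter_upwards [ae_restrict_of_ae hae, ae_restrict_of_ae hrl,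
        ae_restrict_of_ae (Measure.rnDeriv_lt_top (ρ T) volume),
        ae_restrict_mem measurableSet_Ioo] with t ht htr hfin htT
      rw [htr htT]
      have h1 := hq t (T - t) htT.1 (by linarith [htT.2])
      rw [add_sub_cancel] at h1
      have h2 : Tendsto (fun e => (ρ T).real (Ioc t (t + e)) / e) (𝓝[>] 0)
          (𝓝 ((ρ T).rnDeriv volume t).toReal) := by
        refine ht.tendsto_slope_zero_right.congr' ?_
        filter_upwards [self_mem_nhdsWithin] with e he
        have he' : 0 < e := he
        rw [cdf_eq_real, cdf_eq_real, ← Iic_union_Ioc_eq_Iic (show t ≤ t + e by linarith),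
          measureReal_union _ measurableSet_Ioc, smul_eq_mul]
        · ring
        · rw [disjoint_left]
          exact fun z hz hz' => absurd hz (not_le.2 hz'.1)
      -- At a.e. point the distribution function is differentiable, so there the ultrafilter limit
      -- is a true limit and `q` agrees with the Radon–Nikodym derivative.
      have h3 := tendsto_nhds_unique h1 (h2.mono_left hU)
      simp only [hf]
      rw [h3, ENNReal.ofReal_toReal hfin.ne]
    · intro c d hc hd
      refine ⟨2 / min c (T - d), fun s hs t ht hst => ?_⟩
      have := hρ.real_Ioc_le (T := T) (Δ := min c (T - d)) (y := s) (e := t - s)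
        (lt_min hc (by linarith)) ((min_le_left _ _).trans hs.1)
        (by linarith [min_le_right c (T - d), hs.2]) (by linarith)
      rwa [add_sub_cancel] at this

end SupLocation

end

noncomputable section

namespace SupLocation

/-! ### Quantiles -/

/-- The two bounds differ by the atom at `c`, which is small in the application. -/
lemma exists_quantile (μ : Measure ℝ) [IsProbabilityMeasure μ] {p : ℝ} (hp0 : 0 < p)
    (hp1 : p < 1) : ∃ c, p ≤ μ.real (Iic c) ∧ μ.real (Iio c) ≤ p := by
  set s := {x | p ≤ cdf μ x} with hs
  have hne : s.Nonempty :=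
    (((tendsto_order.1 (tendsto_cdf_atTop μ)).1 p hp1).mono fun x hx => hx.le).exists
  obtain ⟨b, hb⟩ := ((tendsto_order.1 (tendsto_cdf_atBot μ)).2 p hp0).exists
  have hbdd : BddBelow s := by
    refine ⟨b, fun x hx => ?_⟩
    by_contra! hlt
    have h1 : p ≤ cdf μ x := hx
    linarith [monotone_cdf μ hlt.le]
  refine ⟨sInf s, ?_, ?_⟩
  · rw [← cdf_eq_real]
    refine ge_of_tendsto (((cdf μ).right_continuous (sInf s)).tendsto.mono_left
      (nhdsWithin_mono _ Ioi_subset_Ici_self)) ?_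
    filter_upwards [self_mem_nhdsWithin] with x hx
    obtain ⟨y, hy, hyx⟩ := exists_lt_of_csInf_lt hne hx
    exact le_trans hy (monotone_cdf μ hyx.le)
  · have hIio := (cdf μ).measure_Iio (tendsto_cdf_atBot μ) (sInf s)
    rw [measure_cdf, sub_zero] at hIio
    have hle : Function.leftLim (cdf μ) (sInf s) ≤ p := by
      refine le_of_tendsto ((monotone_cdf μ).tendsto_leftLim _) ?_
      filter_upwards [self_mem_nhdsWithin] with x hx
      by_contra! hlt
      exact absurd (csInf_le hbdd (show x ∈ s from hlt.le)) (not_le.2 hx)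
    rw [measureReal_def, hIio]
    exact (ENNReal.toReal_mono ENNReal.ofReal_ne_top (ENNReal.ofReal_le_ofReal hle)).trans
      (ENNReal.toReal_ofReal hp0.le).le

lemma abs_sub_mul_le_mixingCoeff {Ω : Type*} {𝒜 ℬ : MeasurableSpace Ω} [MeasurableSpace Ω]
    {P : Measure Ω} [IsProbabilityMeasure P] {A B : Set Ω} (hA : MeasurableSet[𝒜] A) (hB : MeasurableSet[ℬ] B) :
    |P.real (A ∩ B) - P.real A * P.real B| ≤ mixingCoeff P 𝒜 ℬ := by
  refine le_csSup ⟨1, ?_⟩ ⟨A, B, hA, hB, rfl⟩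
  rintro _ ⟨A, B, -, -, rfl⟩
  have h1 : P.real (A ∩ B) ∈ Icc 0 1 := ⟨measureReal_nonneg, measureReal_le_one⟩
  have h2 : P.real A * P.real B ∈ Icc 0 1 :=
    ⟨by positivity, mul_le_one₀ measureReal_le_one measureReal_nonneg measureReal_le_one⟩
  rw [abs_le]
  constructor <;> linarith [h1.1, h1.2, h2.1, h2.2]

variable {Ω : Type*} [MeasurableSpace Ω] {P : Measure Ω} {X : ℝ → Ω → ℝ}

lemma measureReal_mono_of_ae [IsFiniteMeasure P] {s t : Set Ω}
    (h : ∀ᵐ ω ∂P, ω ∈ s → ω ∈ t) : P.real s ≤ P.real t :=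
  ENNReal.toReal_mono (measure_ne_top _ _) (measure_mono_ae h)

/-! ### Mixing over separated blocks -/

/-- The values `x` whose part at or above the level `u` does not show that `x > e`. -/
def lowVals (u e : ℝ) : Set ℝ := {x | u ≤ x → x ≠ 0 → x ≤ e}

lemma measurableSet_lowVals (u e : ℝ) : MeasurableSet (lowVals u e) := by
  have : lowVals u e = (Ici u)ᶜ ∪ ({0} ∪ Iic e) := by
    ext x
    simp only [lowVals, mem_ofPred_eq, mem_union, mem_compl_iff, mem_Ici, mem_singleton_iff,
      mem_Iic]
    tauto
  rw [this]
  measurability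

lemma lowVals_mono {u e e' : ℝ} (h : e ≤ e') : lowVals u e ⊆ lowVals u e' :=
  fun _ hx h1 h2 => (hx h1 h2).trans h

/-- This makes `lowVals` events visible to the σ-algebras in `TailSM`. The point `0` must be
admitted because values below `u` are truncated to it. -/
lemma highPart_mem_iff {Ω : Type*} {X : ℝ → Ω → ℝ} {u e s : ℝ} {ω : Ω} :
    highPart X u s ω ∈ insert 0 (Iic e) ↔ X s ω ∈ lowVals u e := by
  by_cases h : u ≤ X s ω
  · have : highPart X u s ω = X s ω := indicator_of_mem (s := {ω | u ≤ X s ω}) h _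
    rw [this, mem_insert_iff, mem_Iic, lowVals, mem_ofPred_eq]
    tauto
  · have : highPart X u s ω = 0 := indicator_of_notMem (s := {ω | u ≤ X s ω}) h _
    rw [this]
    exact ⟨fun _ h' => absurd h' h, fun _ => mem_insert _ _⟩

/-- The paths that, at the times in the `i`-th translate of `K` by `r`, `i < n`, take values in
`lowVals u (e i)`. -/
def lowPaths (u : ℝ) (K : Set ℝ) (r : ℝ) (n : ℕ) (e : ℕ → ℝ) : Set (ℝ → ℝ) :=
  {z | ∀ i < n, ∀ s ∈ K, z (s + i * r) ∈ lowVals u (e i)}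

section Blocks

variable {u r d z l : ℝ} {K : Set ℝ} {n : ℕ} {e : ℕ → ℝ}

lemma measurableSet_lowPaths (hK : K.Countable) : MeasurableSet (lowPaths u K r n e) := by
  have : lowPaths u K r n e =
      ⋂ i ∈ Iio n, ⋂ s ∈ K, (fun z : ℝ → ℝ => z (s + i * r)) ⁻¹' lowVals u (e i) := by
    ext z; simp [lowPaths]
  rw [this]
  exact MeasurableSet.biInter (to_countable _) fun i _ => MeasurableSet.biInter hK fun s _ =>
    measurable_pi_apply _ (measurableSet_lowVals _ _)

lemma measurableSet_sigmaOf_lowPaths {Ω : Type*} {X : ℝ → Ω → ℝ} (hK : K.Countable) (h : ℝ) {I : Set ℝ}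
    (hI : ∀ i < n, ∀ s ∈ K, s + i * r + h ∈ I) :
    MeasurableSet[sigmaOf (highPart X u) I] {ω | (fun t => X (t + h) ω) ∈ lowPaths u K r n e} := by
  have : {ω | (fun t => X (t + h) ω) ∈ lowPaths u K r n e} =
      ⋂ i ∈ Iio n, ⋂ s ∈ K, highPart X u (s + i * r + h) ⁻¹' insert 0 (Iic (e i)) := by
    ext ω
    simp only [mem_iInter, mem_preimage, highPart_mem_iff]
    rfl
  rw [this]
  refine MeasurableSet.biInter (to_countable _) fun i hi => MeasurableSet.biInter hK fun s hs => ?_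
  have hle : MeasurableSpace.comap (highPart X u (s + i * r + h)) (borel ℝ) ≤
      sigmaOf (highPart X u) I :=
    le_iSup₂_of_le (f := fun s (_ : s ∈ I) => MeasurableSpace.comap (highPart X u s) (borel ℝ))
      _ (hI i hi s hs) le_rfl
  refine hle _ ⟨insert 0 (Iic (e i)), ?_, rfl⟩
  rw [← BorelSpace.measurable_eq (α := ℝ)]
  exact measurableSet_Iic.insert 0

/-- Blocks are split off one at a time, each at the cost of one mixing coefficient. -/
lemma abs_lowPaths_sub_prod_le [IsProbabilityMeasure P] (hmeas : ∀ t, Measurable (X t))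
    (hstat : IsStationary X P) (hK : K.Countable) (hKz : K ⊆ Icc z (z + l)) (hr : 0 ≤ r)
    (hlr : l + d ≤ r) (n : ℕ) (e : ℕ → ℝ) :
    |P.real {ω | (fun t => X t ω) ∈ lowPaths u K r n e} -
        ∏ i ∈ Finset.range n, P.real {ω | ∀ s ∈ K, X s ω ∈ lowVals u (e i)}| ≤
      n * mixingCoeff P (sigmaOf (highPart X u) (Iic 0)) (sigmaOf (highPart X u) (Ici d)) := by
  set α := mixingCoeff P (sigmaOf (highPart X u) (Iic 0)) (sigmaOf (highPart X u) (Ici d))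
  induction n with
  | zero => simp [lowPaths]
  | succ n ih =>
    -- This shift brings the block `n` into `[d, ∞)`; as `l + d ≤ r`, all earlier blocks then lie in
    -- `(-∞, 0]`.
    set h := -(z + n * r - d) with hh
    have hA := measurableSet_sigmaOf_lowPaths (X := X) (u := u) (r := r) (n := n) (e := e) hK h
      (I := Iic 0) (by
        intro i hi s hs
        have hi' : (i : ℝ) + 1 ≤ n := by exact_mod_cast hi
        have h1 : (i + 1) * r ≤ n * r := mul_le_mul_of_nonneg_right hi' hr
        have h2 := (hKz hs).2
        rw [mem_Iic, hh]
        linarith)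
    have hB := measurableSet_sigmaOf_lowPaths (X := X) (u := u) (r := r) (n := 1)
      (e := fun _ => e n) hK (h + n * r) (I := Ici d) (by
        intro i hi s hs
        obtain rfl : i = 0 := by omega
        have h2 := (hKz hs).1
        rw [mem_Ici, hh]
        push_cast
        linarith)
    have hmix := abs_sub_mul_le_mixingCoeff (P := P) hA hB
    have hAB : {ω | (fun t => X (t + h) ω) ∈ lowPaths u K r n e} ∩
        {ω | (fun t => X (t + (h + n * r)) ω) ∈ lowPaths u K r 1 fun _ => e n} =
        {ω | (fun t => X (t + h) ω) ∈ lowPaths u K r (n + 1) e} := by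
      ext ω
      simp only [lowPaths, mem_inter_iff, mem_ofPred_eq]
      constructor
      · rintro ⟨h1, h2⟩ i hi s hs
        rcases Nat.lt_succ_iff_lt_or_eq.1 hi with hi | rfl
        · exact h1 i hi s hs
        · have := h2 0 one_pos s hs
          simpa [add_assoc, add_comm, add_left_comm] using this
      · intro h1
        refine ⟨fun i hi => h1 i (by omega), fun i hi s hs => ?_⟩
        obtain rfl : i = 0 := by omega
        have := h1 n (by omega) s hs
        simpa [add_assoc, add_comm, add_left_comm] using this
    have hB1 : P.real {ω | (fun t => X (t + (h + n * r)) ω) ∈ lowPaths u K r 1 fun _ => e n} =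
        P.real {ω | ∀ s ∈ K, X s ω ∈ lowVals u (e n)} := by
      rw [measureReal_path_shift hmeas hstat _ (measurableSet_lowPaths hK)]
      congr 1
      ext ω
      simp [lowPaths]
    rw [hAB, hB1, measureReal_path_shift hmeas hstat _ (measurableSet_lowPaths hK),
      measureReal_path_shift hmeas hstat _ (measurableSet_lowPaths hK)] at hmix
    rw [Finset.prod_range_succ]
    set p := P.real {ω | (fun t => X t ω) ∈ lowPaths u K r n e}
    set Q := ∏ i ∈ Finset.range n, P.real {ω | ∀ s ∈ K, X s ω ∈ lowVals u (e i)}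
    set g := P.real {ω | ∀ s ∈ K, X s ω ∈ lowVals u (e n)}
    have hg : g ∈ Icc 0 1 := ⟨measureReal_nonneg, measureReal_le_one⟩
    have h3 : |p * g - Q * g| ≤ n * α := by
      rw [← sub_mul, abs_mul, abs_of_nonneg hg.1]
      exact (mul_le_of_le_one_right (abs_nonneg _) hg.2).trans ih
    have h4 := abs_sub_le (P.real {ω | (fun t => X t ω) ∈ lowPaths u K r (n + 1) e}) (p * g)
      (Q * g)
    push_cast
    linarith

/-- A countable set of times in `[z, z + l]` whose translates by multiples of `r` determine the
suprema over the translates of `[z, z + l]`. -/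
lemma exists_countable_isLUB (husc : SampleUSC X) (hsep : IsSupSeparable X P) (hl : 0 ≤ l)
    (z r : ℝ) :
    ∃ K : Set ℝ, K.Countable ∧ K ⊆ Icc z (z + l) ∧ ∀ᵐ ω ∂P, ∀ i : ℕ,
      IsLUB ((fun s => X (s + i * r) ω) '' K) (supOn X (z + i * r) (z + l + i * r) ω) := by
  obtain ⟨S, hSc, hS⟩ := hsep
  refine ⟨((⋃ i : ℕ, (fun s => s + i * r) ⁻¹' S) ∩ Icc z (z + l)) ∪ {z, z + l}, ?_, ?_, ?_⟩
  · refine Countable.union (Countable.mono inter_subset_left ?_) (by simp)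
    exact countable_iUnion fun i => hSc.preimage (add_left_injective _)
  · exact union_subset inter_subset_right (by rintro _ (rfl | rfl) <;> simp [hl])
  · filter_upwards [IsSeparating.ae_isLUB hS husc] with ω hω i
    have := hω (z + i * r) (z + l + i * r) (by linarith)
      ((fun s => s + i * r) '' (((⋃ i : ℕ, (fun s => s + i * r) ⁻¹' S) ∩ Icc z (z + l)) ∪ {z, z + l}))
      ?_ ?_ ⟨z, by simp, rfl⟩ ⟨z + l, by simp, rfl⟩
    · rwa [image_image] at this
    · rintro _ ⟨s, ⟨-, hs⟩ | rfl | rfl, rfl⟩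
      · exact ⟨by linarith [hs.1], by linarith [hs.2]⟩
      · exact ⟨by linarith, by linarith⟩
      · exact ⟨by linarith, by linarith⟩
    · intro s hs
      refine ⟨s - i * r, Or.inl ⟨mem_iUnion.2 ⟨i, by simpa using hs.1⟩, ?_⟩, by simp⟩
      exact ⟨by linarith [hs.2.1], by linarith [hs.2.2]⟩

/-- A value above `c` can belong to `lowVals u c` only if it is `0`. Then `c < 0` and no value is
positive, so the supremum is `0`; hence the exclusion of `M = 0`. -/
lemma forall_mem_lowVals_iff {v : ℝ → ℝ} {M c : ℝ} (hM : IsLUB (v '' K) M) (hM0 : M ≠ 0)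
    (hu : u ≤ c) : (∀ s ∈ K, v s ∈ lowVals u c) ↔ M ≤ c := by
  constructor
  · intro h
    by_cases hall : ∀ s ∈ K, v s ≤ c
    · exact hM.2 (by rintro _ ⟨s, hs, rfl⟩; exact hall s hs)
    push Not at hall
    obtain ⟨s₀, hs₀, hlt⟩ := hall
    have hzero : ∀ s ∈ K, c < v s → v s = 0 := fun s hs hcs => by
      by_contra hne
      exact absurd (h s hs (hu.trans hcs.le) hne) (not_le.2 hcs)
    have h0 := hzero s₀ hs₀ hlt
    refine absurd (le_antisymm ?_ ?_) hM0
    · refine hM.2 ?_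
      rintro _ ⟨s, hs, rfl⟩
      by_cases! hcs : c < v s
      · exact (hzero s hs hcs).le
      · linarith
    · exact h0 ▸ hM.1 ⟨s₀, hs₀, rfl⟩
  · exact fun h s hs _ _ => (hM.1 ⟨s, hs, rfl⟩).trans h

end Blocks

end SupLocation

end

noncomputable section

namespace SupLocation

/-! ### A lower Riemann sum -/

lemma pow_succ_sub_pow_succ_le {x y : ℝ} (hx : 0 ≤ x) (hxy : x ≤ y) (n : ℕ) :
    y ^ (n + 1) - x ^ (n + 1) ≤ (n + 1) * y ^ n * (y - x) := by
  induction n with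
  | zero => simp
  | succ n ih =>
    have hy := hx.trans hxy
    have h1 : x ^ (n + 1) ≤ y ^ (n + 1) := pow_le_pow_left₀ hx hxy _
    have h2 := mul_le_mul_of_nonneg_left ih hy
    have h3 := mul_le_mul_of_nonneg_right h1 (sub_nonneg.2 hxy)
    push_cast
    calc y ^ (n + 1 + 1) - x ^ (n + 1 + 1)
        = y * (y ^ (n + 1) - x ^ (n + 1)) + x ^ (n + 1) * (y - x) := by ring
      _ ≤ y * ((n + 1) * y ^ n * (y - x)) + y ^ (n + 1) * (y - x) := add_le_add h2 h3
      _ = (n + 1 + 1) * y ^ (n + 1) * (y - x) := by ring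

/-- The right-endpoint sum dominates the integral of `x ^ n` over `[0, N / m]`; each term is
compared through the mean value bound above. -/
lemma div_pow_div_le_sum {m : ℕ} (hm : 0 < m) (n N : ℕ) :
    ((N : ℝ) / m) ^ (n + 1) / (n + 1) ≤
      ∑ k ∈ Finset.range N, (1 / m : ℝ) * (((k : ℝ) + 1) / m) ^ n := by
  have hm' : (0 : ℝ) < m := by exact_mod_cast hm
  induction N with
  | zero => simp
  | succ N ih =>
    rw [Finset.sum_range_succ]
    refine le_trans ?_ (add_le_add_left ih _)
    have h := pow_succ_sub_pow_succ_le (x := (N : ℝ) / m) (y := ((N : ℝ) + 1) / m)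
      (by positivity) (by gcongr; linarith) n
    have hsub : ((N : ℝ) + 1) / m - N / m = 1 / m := by ring
    rw [hsub] at h
    have hn : (0 : ℝ) < n + 1 := by positivity
    rw [div_add' _ _ _ hn.ne', div_le_div_iff_of_pos_right hn]
    push_cast
    linarith

variable {Ω : Type*} [MeasurableSpace Ω] {P : Measure Ω} {X : ℝ → Ω → ℝ}
  {u r d z l a : ℝ} {n m : ℕ}

/-! ### The largest of several block suprema -/

/-- For independent uniform variables the chance that one of them is the strict maximum is the
integral of `x ^ (n - 1)`. Here it is discretised at the `k / m` quantiles `c k` of the block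
supremum: block `i₀` lies between consecutive levels and all others at or below the lower one. The
range `m - 2` keeps the indices `k + 1`, `k + 2` strictly between `0` and `m`, and `hu` puts all
these levels at or above `u`. -/
lemma block_strict_lower_bound [IsProbabilityMeasure P] (hmeas : ∀ t, Measurable (X t))
    (husc : SampleUSC X) (hsep : IsSupSeparable X P) (hstat : IsStationary X P)
    (hl : 0 ≤ l) (hr : 0 ≤ r) (hlr : l + d ≤ r) (hm : 0 < m)
    (hatom : ∀ x, P.real {ω | supOn X z (z + l) ω = x} ≤ a)
    (hu : P.real {ω | supOn X z (z + l) ω < u} < 1 / m) (ha : 3 * a ≤ 1 / m)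
    {i₀ : ℕ} (hi₀ : i₀ < n) :
    ∑ k ∈ Finset.range (m - 2), ((1 / m - 3 * a) * (((k : ℝ) + 1) / m - a) ^ (n - 1) -
      2 * n * mixingCoeff P (sigmaOf (highPart X u) (Iic 0)) (sigmaOf (highPart X u) (Ici d))) -
      n * a ≤
    P.real {ω | ∀ j < n, j ≠ i₀ →
      supOn X (z + j * r) (z + l + j * r) ω < supOn X (z + i₀ * r) (z + l + i₀ * r) ω} := by
  obtain ⟨K, hKc, hKz, hKlub⟩ := exists_countable_isLUB husc hsep hl z r
  set α := mixingCoeff P (sigmaOf (highPart X u) (Iic 0)) (sigmaOf (highPart X u) (Ici d))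
  have hm' : (0 : ℝ) < m := by exact_mod_cast hm
  have hzl : z ≤ z + l := by linarith
  have ha0 : 0 ≤ a := measureReal_nonneg.trans (hatom 0)
  have ham : a < 1 / m := by
    have : 0 < (1 : ℝ) / m := by positivity
    linarith
  have hM0 := aemeasurable_supOn hmeas husc hsep hzl
  have : IsProbabilityMeasure (P.map (supOn X z (z + l))) := Measure.isProbabilityMeasure_map hM0
  set G : ℝ → ℝ := fun e => P.real {ω | supOn X z (z + l) ω ≤ e} with hG
  have hGmono : Monotone G := fun e e' he => measureReal_mono fun ω hω => le_trans hω he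
  -- levels
  have hq : ∀ k : ℕ, ∃ c : ℝ, 0 < k → k < m → (k : ℝ) / m ≤ G c ∧ G c ≤ k / m + a := by
    intro k
    by_cases hk : 0 < k ∧ k < m
    · have hk1 : (0 : ℝ) < k := by exact_mod_cast hk.1
      have hk2 : (k : ℝ) < m := by exact_mod_cast hk.2
      obtain ⟨c, h1, h2⟩ := exists_quantile (P.map (supOn X z (z + l))) (p := k / m)
        (by positivity) (by rwa [div_lt_one hm'])
      rw [map_measureReal_apply_of_aemeasurable hM0 measurableSet_Iic] at h1
      rw [map_measureReal_apply_of_aemeasurable hM0 measurableSet_Iio] at h2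
      refine ⟨c, fun _ _ => ⟨h1, ?_⟩⟩
      have hsub : {ω | supOn X z (z + l) ω ≤ c} ⊆
          supOn X z (z + l) ⁻¹' Iio c ∪ {ω | supOn X z (z + l) ω = c} := fun ω hω =>
        (lt_or_eq_of_le (show supOn X z (z + l) ω ≤ c from hω)).imp id id
      calc G c ≤ _ := measureReal_mono hsub
        _ ≤ _ := measureReal_union_le _ _
        _ ≤ k / m + a := add_le_add h2 (hatom c)
    · exact ⟨0, fun h1 h2 => absurd ⟨h1, h2⟩ hk⟩
  choose c hc using hq
  have hcmono : ∀ i j, 0 < i → i < j → j < m → c i < c j := by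
    intro i j hi hij hj
    by_contra! hle
    have h1 := (hc j (hi.trans hij) hj).1
    have h2 := (hc i hi (hij.trans hj)).2
    have h3 := hGmono hle
    have h4 : ((i : ℝ) + 1) / m ≤ j / m := by
      gcongr
      exact_mod_cast hij
    rw [add_div] at h4
    linarith
  have hcu : ∀ k, 0 < k → k < m → u ≤ c k := by
    intro k hk0 hkm
    by_contra! hlt
    have h1 := (hc k hk0 hkm).1
    have h2 : G (c k) ≤ P.real {ω | supOn X z (z + l) ω < u} :=
      measureReal_mono fun ω hω => lt_of_le_of_lt hω hlt
    have h3 : (1 : ℝ) / m ≤ k / m := by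
      gcongr
      exact_mod_cast hk0
    linarith
  -- comparison of `g` and `G`
  set g : ℝ → ℝ := fun e => P.real {ω | ∀ s ∈ K, X s ω ∈ lowVals u e} with hg
  have hgG : ∀ e, u ≤ e → G e - a ≤ g e ∧ g e ≤ G e + a := by
    intro e he
    have hiff : ∀ᵐ ω ∂P, supOn X z (z + l) ω ≠ 0 →
        ((∀ s ∈ K, X s ω ∈ lowVals u e) ↔ supOn X z (z + l) ω ≤ e) := by
      filter_upwards [hKlub] with ω hω hne
      have := hω 0
      simp only [Nat.cast_zero, zero_mul, add_zero] at this
      exact forall_mem_lowVals_iff this hne he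
    constructor
    · have : G e ≤ P.real ({ω | ∀ s ∈ K, X s ω ∈ lowVals u e} ∪
          {ω | supOn X z (z + l) ω = 0}) := measureReal_mono_of_ae (by
        filter_upwards [hiff] with ω hω hle
        by_cases h0 : supOn X z (z + l) ω = 0
        · exact Or.inr h0
        · exact Or.inl ((hω h0).2 hle))
      linarith [this.trans (measureReal_union_le _ _), hatom 0]
    · have : g e ≤ P.real ({ω | supOn X z (z + l) ω ≤ e} ∪
          {ω | supOn X z (z + l) ω = 0}) := measureReal_mono_of_ae (by
        filter_upwards [hiff] with ω hω hle
        by_cases h0 : supOn X z (z + l) ω = 0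
        · exact Or.inr h0
        · exact Or.inl ((hω h0).1 hle))
      linarith [this.trans (measureReal_union_le _ _), hatom 0]
  -- the events on which the block `i₀` alone exceeds a level
  set A : ℕ → Set Ω := fun k => {ω | (fun t => X t ω) ∈
    lowPaths u K r n fun i => if i = i₀ then c (k + 2) else c (k + 1)} with hA
  set B : ℕ → Set Ω := fun k => {ω | (fun t => X t ω) ∈ lowPaths u K r n fun _ => c (k + 1)}
    with hB
  have hmA : ∀ k, MeasurableSet (A k) := fun k =>
    (measurable_pi_lambda _ fun t => hmeas t) (measurableSet_lowPaths hKc)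
  have hmB : ∀ k, MeasurableSet (B k) := fun k =>
    (measurable_pi_lambda _ fun t => hmeas t) (measurableSet_lowPaths hKc)
  have hBA : ∀ k, k < m - 2 → B k ⊆ A k := by
    intro k hk ω hω i hi s hs
    refine lowVals_mono ?_ (hω i hi s hs)
    dsimp only
    split_ifs
    · exact (hcmono _ _ (by omega) (by omega) (by omega)).le
    · exact le_rfl
  have hE : ∀ k, k < m - 2 →
      (1 / m - 3 * a) * (((k : ℝ) + 1) / m - a) ^ (n - 1) - 2 * n * α ≤ P.real (A k \ B k) := by
    intro k hk
    have hdiff := measureReal_sdiff (μ := P) (hBA k hk) (hmB k)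
    have hPA := abs_le.1 (abs_lowPaths_sub_prod_le (u := u) (d := d) hmeas hstat hKc hKz hr hlr n
      fun i => if i = i₀ then c (k + 2) else c (k + 1))
    have hPB := abs_le.1 (abs_lowPaths_sub_prod_le (u := u) (d := d) hmeas hstat hKc hKz hr hlr n
      fun _ => c (k + 1))
    have hmem : i₀ ∈ Finset.range n := Finset.mem_range.2 hi₀
    have hprodA : ∏ i ∈ Finset.range n, P.real {ω | ∀ s ∈ K, X s ω ∈
        lowVals u (if i = i₀ then c (k + 2) else c (k + 1))} =
        g (c (k + 2)) * g (c (k + 1)) ^ (n - 1) := by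
      rw [← Finset.mul_prod_erase _ _ hmem, if_pos rfl]
      congr 1
      rw [Finset.prod_congr rfl (g := fun _ => g (c (k + 1))) fun i hi => by
        rw [if_neg (Finset.ne_of_mem_erase hi)]]
      rw [Finset.prod_const, Finset.card_erase_of_mem hmem, Finset.card_range]
    have hprodB : ∏ i ∈ Finset.range n, P.real {ω | ∀ s ∈ K, X s ω ∈ lowVals u (c (k + 1))} =
        g (c (k + 1)) * g (c (k + 1)) ^ (n - 1) := by
      rw [Finset.prod_const, Finset.card_range, mul_pow_sub_one (by omega)]
    rw [hprodA] at hPA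
    rw [hprodB] at hPB
    have h1 := hgG _ (hcu (k + 1) (by omega) (by omega))
    have h2 := hgG _ (hcu (k + 2) (by omega) (by omega))
    have h3 := hc (k + 1) (by omega) (by omega)
    have h4 := hc (k + 2) (by omega) (by omega)
    push_cast at h3 h4
    have hstep : ((k : ℝ) + 2) / m = (k + 1) / m + 1 / m := by ring
    have hk1 : (1 : ℝ) / m ≤ (k + 1) / m := by
      gcongr
      linarith [(Nat.cast_nonneg k : (0 : ℝ) ≤ k)]
    -- One `a` is lost to the quantile `c (k + 1)` overshooting, and two more to replacing `G` by
    -- `g` at both levels.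
    have hmul : (1 / m - 3 * a) * (((k : ℝ) + 1) / m - a) ^ (n - 1) ≤
        (g (c (k + 2)) - g (c (k + 1))) * g (c (k + 1)) ^ (n - 1) := by
      refine mul_le_mul (by linarith) (pow_le_pow_left₀ (by linarith) (by linarith) _)
        (pow_nonneg (by linarith) _) (by linarith)
    rw [hdiff]
    linarith [hPA.1, hPB.2]
  -- For `k < k'` the event `A k` keeps every block at or below `c (k + 2) ≤ c (k' + 1)`, hence lies
  -- in `B k'`.
  have hdisj : ((Finset.range (m - 2) : Finset ℕ) : Set ℕ).PairwiseDisjoint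
      fun k => A k \ B k := by
    have key : ∀ k k', k < k' → k' < m - 2 → Disjoint (A k \ B k) (A k' \ B k') := by
      intro k k' hkk' hk'
      rw [disjoint_left]
      rintro ω ⟨hAk, -⟩ ⟨-, hBk'⟩
      refine hBk' fun i hi s hs => lowVals_mono ?_ (hAk i hi s hs)
      dsimp only
      have hle : c (k + 2) ≤ c (k' + 1) := by
        rcases eq_or_lt_of_le (show k + 1 ≤ k' from hkk') with rfl | hlt
        · exact le_rfl
        · exact (hcmono _ _ (by omega) (by omega) (by omega)).le
      split_ifs
      · exact hle
      · exact (hcmono (k + 1) (k + 2) (by omega) (by omega) (by omega)).le.trans hle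
    intro k hk k' hk' hne
    rcases lt_or_gt_of_ne hne with hlt | hlt
    · exact key k k' hlt (by simpa using hk')
    · exact (key k' k hlt (by simpa using hk)).symm
  have hunion := measureReal_biUnion_finset (μ := P) hdisj fun k _ => (hmA k).diff (hmB k)
  have hatoms : ∀ i : ℕ, P.real {ω | supOn X (z + i * r) (z + l + i * r) ω = 0} ≤ a := by
    intro i
    have := measure_supOn_mem_shift hmeas husc hsep hstat hzl (i * r) (measurableSet_singleton 0)
    refine le_trans (le_of_eq ?_) (hatom 0)
    exact congrArg ENNReal.toReal this
  set F := {ω | ∀ j < n, j ≠ i₀ →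
      supOn X (z + j * r) (z + l + j * r) ω < supOn X (z + i₀ * r) (z + l + i₀ * r) ω} with hF
  -- Unless some block supremum equals `0`, the `lowVals` conditions are true comparisons with the
  -- level, and the level `c (k + 1)` separates block `i₀` from the others.
  have hcover : P.real (⋃ k ∈ Finset.range (m - 2), A k \ B k) ≤ P.real (F ∪
      ⋃ i ∈ Finset.range n, {ω | supOn X (z + i * r) (z + l + i * r) ω = 0}) := by
    refine measureReal_mono_of_ae ?_
    filter_upwards [hKlub] with ω hω hmem
    by_cases h0 : ∃ i < n, supOn X (z + i * r) (z + l + i * r) ω = 0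
    · obtain ⟨i, hi, h0⟩ := h0
      exact Or.inr (mem_biUnion (Finset.mem_coe.2 (Finset.mem_range.2 hi)) h0)
    left
    push Not at h0
    simp only [mem_iUnion, Finset.mem_range, exists_prop] at hmem
    obtain ⟨k, hk, hAk, hBk⟩ := hmem
    have huk := hcu (k + 1) (by omega) (by omega)
    have hother : ∀ j < n, j ≠ i₀ → ∀ s ∈ K, X (s + j * r) ω ∈ lowVals u (c (k + 1)) := by
      intro j hj hne s hs
      have := hAk j hj s hs
      simpa only [if_neg hne] using this
    intro j hj hne
    have hj1 := (forall_mem_lowVals_iff (hω j) (h0 j hj) huk).1 (hother j hj hne)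
    have hi1 : ¬ ∀ s ∈ K, X (s + i₀ * r) ω ∈ lowVals u (c (k + 1)) := by
      intro hall
      refine hBk fun i hi s hs => ?_
      by_cases hii : i = i₀
      · subst hii; exact hall s hs
      · exact hother i hi hii s hs
    rw [forall_mem_lowVals_iff (hω i₀) (h0 i₀ hi₀) huk, not_le] at hi1
    exact hj1.trans_lt hi1
  have hbad : P.real (⋃ i ∈ Finset.range n,
      {ω | supOn X (z + i * r) (z + l + i * r) ω = 0}) ≤ n * a := by
    refine (measureReal_biUnion_finset_le _ _).trans ?_
    refine (Finset.sum_le_card_nsmul _ _ _ fun i _ => hatoms i).trans ?_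
    simp
  have hsum := Finset.sum_le_sum fun k (hk : k ∈ Finset.range (m - 2)) =>
    hE k (Finset.mem_range.1 hk)
  rw [← hunion] at hsum
  linarith [hcover.trans (measureReal_union_le _ _)]

end SupLocation

end

noncomputable section

namespace SupLocation

variable {Ω : Type*} [MeasurableSpace Ω] {P : Measure Ω} {X : ℝ → Ω → ℝ}

/-! ### Asymptotic equidistribution of the largest block supremum -/

lemma exists_lt_sub_two_div_pow (n : ℕ) {η : ℝ} (hη : 0 < η) :
    ∃ m : ℕ, 0 < m ∧ 1 / ((n : ℝ) + 1) - η < (((m - 2 : ℕ) : ℝ) / m) ^ (n + 1) / (n + 1) := by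
  have h1 : Tendsto (fun m : ℕ => ((m - 2 : ℕ) : ℝ) / m) atTop (𝓝 1) := by
    have h2 : Tendsto (fun m : ℕ => 1 - 2 / (m : ℝ)) atTop (𝓝 (1 - 0)) :=
      tendsto_const_nhds.sub (tendsto_const_div_atTop_nhds_zero_nat 2)
    rw [sub_zero] at h2
    refine h2.congr' ?_
    filter_upwards [eventually_ge_atTop 2] with m hm
    have : (m : ℝ) ≠ 0 := by positivity
    rw [Nat.cast_sub hm]
    field_simp
    push_cast
    ring
  have h3 := (h1.pow (n + 1)).div_const ((n : ℝ) + 1)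
  rw [one_pow] at h3
  obtain ⟨m, hm0, hm⟩ := ((eventually_gt_atTop 0).and
    ((tendsto_order.1 h3).1 (1 / ((n : ℝ) + 1) - η) (by linarith))).exists
  exact ⟨m, hm0, hm⟩

lemma eventually_block_strict [IsProbabilityMeasure P] (hmeas : ∀ t, Measurable (X t))
    (husc : SampleUSC X) (hsep : IsSupSeparable X P) (hstat : IsStationary X P)
    (htail : TailSM X P) (hatom : AtomsVanish X P) (x₀ : ℝ) {ℓ ρ : ℝ} (hℓ : 0 < ℓ) (hℓρ : ℓ < ρ)
    {n i₀ : ℕ} (hi₀ : i₀ < n) {η : ℝ} (hη : 0 < η) :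
    ∀ᶠ T in atTop, 1 / (n : ℝ) - η ≤ P.real {ω | ∀ j < n, j ≠ i₀ →
      supOn X (x₀ * T + j * (ρ * T)) (x₀ * T + ℓ * T + j * (ρ * T)) ω <
        supOn X (x₀ * T + i₀ * (ρ * T)) (x₀ * T + ℓ * T + i₀ * (ρ * T)) ω} := by
  obtain ⟨φ, hφ, hmix⟩ := htail
  obtain ⟨n, rfl⟩ : ∃ n', n = n' + 1 := ⟨n - 1, by omega⟩
  obtain ⟨m, hm, hmη⟩ := exists_lt_sub_two_div_pow n hη
  have hm' : (0 : ℝ) < m := by exact_mod_cast hm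
  -- The single scale `δ * T` serves twice: it fits into the gaps between blocks, for the mixing,
  -- and into a block, so that a block supremum reaches `φ (δ * T)` with high probability.
  set δ := min (ρ - ℓ) ℓ with hδ
  have hδ0 : 0 < δ := lt_min (by linarith) hℓ
  have hδℓ : δ ≤ ℓ := min_le_right _ _
  have hδρ : ℓ + δ ≤ ρ := by linarith [min_le_left (ρ - ℓ) ℓ]
  set a : ℝ → ℝ := fun T => (⨆ x : ℝ, P {ω | supOn X 0 (ℓ * T) ω = x}).toReal with ha
  set α : ℝ → ℝ := fun T => mixingCoeff P (sigmaOf (highPart X (φ (δ * T))) (Iic 0))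
    (sigmaOf (highPart X (φ (δ * T))) (Ici (δ * T))) with hα
  have ha_lim : Tendsto a atTop (𝓝 0) := by
    have := (ENNReal.tendsto_toReal ENNReal.zero_ne_top).comp
      (hatom.comp (tendsto_id.const_mul_atTop hℓ))
    exact this
  have hα_lim : Tendsto α atTop (𝓝 0) := hmix.comp (tendsto_id.const_mul_atTop hδ0)
  have htail_lim : Tendsto (fun T : ℝ => 1 - P.real {ω | φ (δ * T) ≤ supOn X 0 (δ * T) ω}) atTop
      (𝓝 0) := by
    have := (ENNReal.tendsto_toReal ENNReal.one_ne_top).comp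
      (hφ.comp (tendsto_id.const_mul_atTop hδ0))
    have := this.const_sub 1
    simpa [measureReal_def] using this
  -- The lower bound is continuous in the atom size and the mixing coefficient, and at `(0, 0)` it
  -- is the Riemann sum for `1 / (n + 1)`.
  set Φ : ℝ → ℝ → ℝ := fun a α => ∑ k ∈ Finset.range (m - 2),
    ((1 / m - 3 * a) * (((k : ℝ) + 1) / m - a) ^ n - 2 * (n + 1 : ℝ) * α) - (n + 1 : ℝ) * a with hΦ
  have hΦ_lim : Tendsto (fun T => Φ (a T) (α T)) atTop (𝓝 (Φ 0 0)) := by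
    refine Tendsto.sub (tendsto_finsetSum _ fun k _ => ?_) (ha_lim.const_mul _)
    exact ((((ha_lim.const_mul 3).const_sub _)).mul ((ha_lim.const_sub _).pow _)).sub
      (hα_lim.const_mul _)
  have hΦ0 : 1 / ((n : ℝ) + 1) - η < Φ 0 0 := by
    refine hmη.trans_le ((div_pow_div_le_sum hm n (m - 2)).trans (le_of_eq ?_))
    simp [hΦ]
  have hinv : (0 : ℝ) < 1 / m := by positivity
  filter_upwards [(tendsto_order.1 hΦ_lim).1 _ hΦ0, (tendsto_order.1 htail_lim).2 _ hinv,
    (tendsto_order.1 (ha_lim.const_mul 3)).2 (1 / m) (by simpa using hinv),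
    eventually_gt_atTop 0] with T h1 h2 h3 hT
  have hlT : 0 ≤ ℓ * T := by positivity
  have hzero : ∀ {A : Set ℝ}, MeasurableSet A →
      P.real {ω | supOn X (x₀ * T) (x₀ * T + ℓ * T) ω ∈ A} =
      P.real {ω | supOn X 0 (ℓ * T) ω ∈ A} := by
    intro A hA
    have := measure_supOn_mem_shift hmeas husc hsep hstat hlT (x₀ * T) hA
    rw [zero_add, add_comm (ℓ * T)] at this
    exact congrArg ENNReal.toReal this
  have hδT : 0 ≤ δ * T := by positivity
  have hδℓT : δ * T ≤ ℓ * T := by gcongr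
  have key := block_strict_lower_bound (z := x₀ * T) (l := ℓ * T) (r := ρ * T) (d := δ * T)
    (u := φ (δ * T)) (a := a T) (n := n + 1) hmeas husc hsep hstat hlT
    (by have := hℓ.trans hℓρ; positivity) (by nlinarith) hm
    (fun x => ?_) ?_ h3.le hi₀
  · refine le_trans ?_ key
    simp only [hΦ] at h1
    push_cast
    exact h1.le
  · rw [show {ω | supOn X (x₀ * T) (x₀ * T + ℓ * T) ω = x} =
      {ω | supOn X (x₀ * T) (x₀ * T + ℓ * T) ω ∈ ({x} : Set ℝ)} from rfl,
      hzero (measurableSet_singleton x)]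
    refine ENNReal.toReal_mono ?_ (le_iSup (fun x => P {ω | supOn X 0 (ℓ * T) ω = x}) x)
    exact ((iSup_le fun x => prob_le_one).trans_lt ENNReal.one_lt_top).ne
  · rw [show {ω | supOn X (x₀ * T) (x₀ * T + ℓ * T) ω < φ (δ * T)} =
      {ω | supOn X (x₀ * T) (x₀ * T + ℓ * T) ω ∈ Iio (φ (δ * T))} from rfl, hzero measurableSet_Iio]
    refine lt_of_le_of_lt ?_ h2
    have hnm : NullMeasurableSet {ω | φ (δ * T) ≤ supOn X 0 (δ * T) ω} P :=
      (aemeasurable_supOn hmeas husc hsep hδT).nullMeasurable measurableSet_Ici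
    have hcompl : P.real {ω | φ (δ * T) ≤ supOn X 0 (δ * T) ω}ᶜ =
        1 - P.real {ω | φ (δ * T) ≤ supOn X 0 (δ * T) ω} := by
      have := measureReal_compl₀ hnm
      rwa [probReal_univ] at this
    rw [← hcompl]
    refine measureReal_mono fun ω hω hle => ?_
    have h4 := supOn_mono (husc ω) hδT le_rfl hδℓT
    have h5 : supOn X 0 (ℓ * T) ω < φ (δ * T) := hω
    have h6 : φ (δ * T) ≤ supOn X 0 (δ * T) ω := hle
    linarith

/-- The other `n - 1` blocks are strict maxima with probability nearly `1 / n` each. These events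
are disjoint from each other and from the weak maximality of block `i₀`, which leaves it only about
`1 / n`. -/
lemma eventually_block_le [IsProbabilityMeasure P] (hmeas : ∀ t, Measurable (X t))
    (husc : SampleUSC X) (hsep : IsSupSeparable X P) (hstat : IsStationary X P)
    (htail : TailSM X P) (hatom : AtomsVanish X P) (x₀ : ℝ) {ℓ ρ : ℝ} (hℓ : 0 < ℓ) (hℓρ : ℓ < ρ)
    {n i₀ : ℕ} (hi₀ : i₀ < n) {η : ℝ} (hη : 0 < η) :
    ∀ᶠ T in atTop, P.real {ω | ∀ j < n,
      supOn X (x₀ * T + j * (ρ * T)) (x₀ * T + ℓ * T + j * (ρ * T)) ω ≤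
        supOn X (x₀ * T + i₀ * (ρ * T)) (x₀ * T + ℓ * T + i₀ * (ρ * T)) ω} ≤ 1 / n + η := by
  have hn : (0 : ℝ) < n := by exact_mod_cast (Nat.zero_le _).trans_lt hi₀
  have hall : ∀ᶠ T in atTop, ∀ i ∈ Finset.range n, 1 / (n : ℝ) - η / n ≤ P.real {ω | ∀ j < n, j ≠ i →
      supOn X (x₀ * T + j * (ρ * T)) (x₀ * T + ℓ * T + j * (ρ * T)) ω <
        supOn X (x₀ * T + i * (ρ * T)) (x₀ * T + ℓ * T + i * (ρ * T)) ω} :=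
    (Filter.eventually_all_finset _).2 fun i hi => eventually_block_strict hmeas husc hsep hstat
      htail hatom x₀ hℓ hℓρ (Finset.mem_range.1 hi) (by positivity)
  filter_upwards [hall, eventually_ge_atTop 0] with T hT hT0
  set M : ℕ → Ω → ℝ := fun j =>
    supOn X (x₀ * T + j * (ρ * T)) (x₀ * T + ℓ * T + j * (ρ * T)) with hM
  have hMm : ∀ j, AEMeasurable (M j) P := fun j =>
    aemeasurable_supOn hmeas husc hsep (by have : 0 ≤ ℓ * T := by positivity
                                           linarith)
  change P.real {ω | ∀ j < n, M j ω ≤ M i₀ ω} ≤ 1 / n + η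
  set E : ℕ → Set Ω := fun i =>
    if i = i₀ then {ω | ∀ j < n, M j ω ≤ M i₀ ω} else {ω | ∀ j < n, j ≠ i → M j ω < M i ω} with hE
  have hEm : ∀ i ∈ Finset.range n, NullMeasurableSet (E i) P := by
    intro i _
    simp only [hE]
    split_ifs
    · simp only [ofPred_forall]
      exact .iInter fun j => .iInter fun _ => nullMeasurableSet_le (hMm j) (hMm i₀)
    · simp only [ofPred_forall]
      exact .iInter fun j => .iInter fun _ => .iInter fun _ =>
        nullMeasurableSet_lt (hMm j) (hMm i)
  have hEd : (Finset.range n : Set ℕ).Pairwise (Function.onFun (AEDisjoint P) E) := by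
    have key : ∀ i < n, ∀ k < n, i ≠ k → k ≠ i₀ → Disjoint (E i) (E k) := by
      intro i hi k hk hne hki
      rw [disjoint_left]
      intro ω h1 h2
      simp only [hE, if_neg hki] at h2
      have h3 := h2 i hi hne
      by_cases hii : i = i₀
      · simp only [hE, if_pos hii] at h1
        have := h1 k hk
        rw [← hii] at this
        exact absurd h3 (not_lt.2 this)
      · simp only [hE, if_neg hii] at h1
        exact absurd h3 (not_lt.2 (h1 k hk hne.symm).le)
    intro i hi k hk hne
    refine Disjoint.aedisjoint ?_
    have hi' : i < n := by simpa using hi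
    have hk' : k < n := by simpa using hk
    by_cases hki : k = i₀
    · exact (key k hk' i hi' hne.symm (by rw [← hki]; exact hne)).symm
    · exact key i hi' k hk' hne hki
  have hsum : ∑ i ∈ Finset.range n, P.real (E i) ≤ 1 := by
    have h1 := sum_measure_le_measure_univ hEm hEd
    rw [measure_univ] at h1
    have h2 := ENNReal.toReal_mono ENNReal.one_ne_top h1
    rwa [ENNReal.toReal_sum fun i _ => measure_ne_top _ _, ENNReal.toReal_one] at h2
  rw [← Finset.add_sum_erase _ _ (Finset.mem_range.2 hi₀)] at hsum
  have hE0 : E i₀ = {ω | ∀ j < n, M j ω ≤ M i₀ ω} := by simp [hE]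
  have hlow : ((n : ℝ) - 1) * (1 / n - η / n) ≤
      ∑ i ∈ (Finset.range n).erase i₀, P.real (E i) := by
    have := Finset.card_nsmul_le_sum ((Finset.range n).erase i₀) (fun i => P.real (E i))
      (1 / n - η / n) fun i hi => by
        have := hT i (Finset.mem_of_mem_erase hi)
        simp only [hE, if_neg (Finset.ne_of_mem_erase hi)]
        exact this
    rw [Finset.card_erase_of_mem (Finset.mem_range.2 hi₀), Finset.card_range, nsmul_eq_mul,
      Nat.cast_sub (by omega), Nat.cast_one] at this
    exact this
  rw [← hE0]
  have hid : ((n : ℝ) - 1) * (1 / n - η / n) = 1 - 1 / n - η + η / n := by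
    field_simp
    ring
  have : 0 ≤ η / n := by positivity
  linarith

/-- Asymptotically, the location of the supremum falls in one of `n` equal separated blocks with
probability at most `1 / n`. -/
lemma eventually_supLoc_mem_block_le [IsProbabilityMeasure P] (hmeas : ∀ t, Measurable (X t))
    (husc : SampleUSC X) (hsep : IsSupSeparable X P) (hstat : IsStationary X P)
    (htail : TailSM X P) (hatom : AtomsVanish X P) {x₀ ℓ ρ : ℝ} (hx₀ : 0 ≤ x₀) (hℓ : 0 < ℓ)
    (hℓρ : ℓ < ρ) {n i₀ : ℕ} (hi₀ : i₀ < n) (hend : x₀ + ℓ + (n - 1) * ρ ≤ 1)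
    {η : ℝ} (hη : 0 < η) :
    ∀ᶠ T in atTop, P.real {ω | supLoc X 0 T ω ∈
      Icc ((x₀ + i₀ * ρ) * T) ((x₀ + i₀ * ρ + ℓ) * T)} ≤ 1 / n + η := by
  filter_upwards [eventually_block_le hmeas husc hsep hstat htail hatom x₀ hℓ hℓρ hi₀ hη,
    eventually_gt_atTop 0] with T hT hT0
  -- All blocks lie in `[0, T]`, so the block that contains the location attains the global maximum.
  refine (measureReal_mono fun ω hω j hj => ?_).trans hT
  have hω' : supLoc X 0 T ω ∈ Icc ((x₀ + i₀ * ρ) * T) ((x₀ + i₀ * ρ + ℓ) * T) := hω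
  have hρ : 0 < ρ := hℓ.trans hℓρ
  have hj' : (j : ℝ) ≤ n - 1 := by
    have : (j : ℝ) + 1 ≤ n := by exact_mod_cast hj
    linarith
  have hjρ : (j : ℝ) * ρ ≤ (n - 1) * ρ := by gcongr
  have h1 : 0 ≤ x₀ * T + j * (ρ * T) := by positivity
  have h2 : x₀ * T + ℓ * T + j * (ρ * T) ≤ T := by
    have : (x₀ + ℓ + j * ρ) * T ≤ 1 * T := by gcongr; linarith
    linarith
  have h3 : 0 < ℓ * T := by positivity
  calc supOn X (x₀ * T + j * (ρ * T)) (x₀ * T + ℓ * T + j * (ρ * T)) ω ≤ supOn X 0 T ω :=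
        supOn_mono (husc ω) (by linarith) h1 h2
    _ = X (supLoc X 0 T ω) ω := (apply_supLoc (husc ω) hT0.le).symm
    _ ≤ _ := le_supOn (husc ω) ⟨by linarith [hω'.1], by linarith [hω'.2]⟩

/-- Adjacent cells leave no gap for mixing, so a strip of relative width `1 / (2 * m * p)` is cut
off the right end of each. The strip is itself one of `m * p` separated blocks, hence has
probability about `1 / (m * p)`, which is negligible for large `p`. -/
lemma eventually_supLoc_mem_cell_le [IsProbabilityMeasure P] (hmeas : ∀ t, Measurable (X t))
    (husc : SampleUSC X) (hsep : IsSupSeparable X P) (hstat : IsStationary X P)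
    (htail : TailSM X P) (hatom : AtomsVanish X P) {m j : ℕ} (hj : j < m) {η : ℝ} (hη : 0 < η) :
    ∀ᶠ T in atTop, P.real {ω | supLoc X 0 T ω ∈
      Icc ((j : ℝ) / m * T) (((j : ℝ) + 1) / m * T)} ≤ 1 / m + η := by
  have hm : 0 < m := (Nat.zero_le _).trans_lt hj
  have hm' : (0 : ℝ) < m := by exact_mod_cast hm
  obtain ⟨p, hp⟩ := exists_nat_gt (3 / η)
  have hp0 : (0 : ℝ) < p := (by positivity : 0 < 3 / η).trans hp
  have hp1 : 0 < p := by exact_mod_cast hp0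
  have hm1 : (1 : ℝ) ≤ m := by exact_mod_cast hm
  have hpη : 1 / ((m * p : ℕ) : ℝ) ≤ η / 3 := by
    rw [div_lt_iff₀ hη] at hp
    rw [div_le_div_iff₀ (by positivity) (by norm_num)]
    push_cast
    nlinarith [mul_le_mul_of_nonneg_right hm1 (by positivity : 0 ≤ p * η)]
  have hblock := eventually_supLoc_mem_block_le (x₀ := 0) (ℓ := 1 / m - 1 / (2 * m * p))
    (ρ := 1 / m) hmeas husc hsep hstat htail hatom le_rfl (by
      rw [sub_pos]
      gcongr
      have : (1 : ℝ) ≤ p := by exact_mod_cast hp1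
      nlinarith) (by
      have : (0 : ℝ) < 1 / (2 * m * p) := by positivity
      linarith) hj (by
      have : (0 : ℝ) < 1 / (2 * m * p) := by positivity
      have h2 : (1 : ℝ) / m + (m - 1) * (1 / m) = 1 := by field_simp; ring
      linarith) (show 0 < η / 3 by positivity)
  -- With period `1 / (m * p)` and offset `1 / (2 * m * p)`, the block of this index ends exactly at
  -- `(j + 1) / m`.
  have hidx : p * j + (p - 1) < m * p := by
    have : p * (j + 1) ≤ p * m := Nat.mul_le_mul_left _ hj
    rw [mul_comm m p]
    rw [mul_add] at this
    omega
  have hgap := eventually_supLoc_mem_block_le (x₀ := 1 / (2 * m * p)) (ℓ := 1 / (2 * m * p))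
    (ρ := 1 / (m * p)) hmeas husc hsep hstat htail hatom (by positivity) (by positivity) (by
      gcongr
      linarith) hidx (by
      push_cast
      refine le_of_eq ?_
      field_simp
      ring) (show 0 < η / 3 by positivity)
  filter_upwards [hblock, hgap, eventually_gt_atTop 0] with T h1 h2 hT
  have hsub : {ω | supLoc X 0 T ω ∈ Icc ((j : ℝ) / m * T) (((j : ℝ) + 1) / m * T)} ⊆
      {ω | supLoc X 0 T ω ∈ Icc ((0 + j * (1 / m : ℝ)) * T)
        ((0 + j * (1 / m : ℝ) + (1 / m - 1 / (2 * m * p))) * T)} ∪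
      {ω | supLoc X 0 T ω ∈ Icc ((1 / (2 * m * p) + ((p * j + (p - 1) : ℕ) : ℝ) * (1 / (m * p))) * T)
        ((1 / (2 * m * p) + ((p * j + (p - 1) : ℕ) : ℝ) * (1 / (m * p)) + 1 / (2 * m * p)) * T)} := by
    intro ω hω
    have e1 : (0 + j * (1 / m : ℝ)) = j / m := by ring
    have e2 : (0 + j * (1 / m : ℝ) + (1 / m - 1 / (2 * m * p))) = (j + 1) / m - 1 / (2 * m * p) := by
      ring
    have e3 : (1 / (2 * m * p) + ((p * j + (p - 1) : ℕ) : ℝ) * (1 / (m * p))) =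
        (j + 1) / m - 1 / (2 * m * p) := by
      push_cast [Nat.cast_sub hp1]
      field_simp
      ring
    have e4 : ((j : ℝ) + 1) / m - 1 / (2 * m * p) + 1 / (2 * m * p) = (j + 1) / m := by ring
    rw [e2, e1, e3, e4]
    rcases le_total (supLoc X 0 T ω) (((j + 1) / m - 1 / (2 * m * p)) * T) with hle | hle
    · exact Or.inl ⟨hω.1, hle⟩
    · exact Or.inr ⟨hle, hω.2⟩
  calc P.real _ ≤ _ := measureReal_mono hsub
    _ ≤ _ := measureReal_union_le _ _
    _ ≤ (1 / m + η / 3) + (1 / ((m * p : ℕ) : ℝ) + η / 3) := add_le_add h1 h2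
    _ ≤ 1 / m + η := by linarith

end SupLocation

end

noncomputable section

namespace SupLocation

/-! ### Uniform convergence of the distribution functions -/

variable {ρ : ℝ → Measure ℝ}

lemma real_Iic_le_of_cells {μ : Measure ℝ} [IsFiniteMeasure μ] {T η : ℝ} {m : ℕ} (hm : 0 < m)
    (hsupp : μ (Icc 0 T)ᶜ = 0)
    (hcell : ∀ j < m, μ.real (Icc ((j : ℝ) / m * T) (((j : ℝ) + 1) / m * T)) ≤ 1 / m + η)
    {k : ℕ} (hk : k < m) :
    μ.real (Iic (((k : ℝ) + 1) / m * T)) ≤ ((k : ℝ) + 1) * (1 / m + η) := by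
  have hm' : (0 : ℝ) < m := by exact_mod_cast hm
  induction k with
  | zero =>
    have hsub : Iic ((((0 : ℕ) : ℝ) + 1) / m * T) ⊆
        (Icc 0 T)ᶜ ∪ Icc (((0 : ℕ) : ℝ) / m * T) ((((0 : ℕ) : ℝ) + 1) / m * T) := by
      intro x hx
      by_cases h0 : 0 ≤ x
      · exact Or.inr ⟨by simpa using h0, hx⟩
      · exact Or.inl fun h => h0 h.1
    have h1 := (measureReal_mono (μ := μ) hsub).trans (measureReal_union_le _ _)
    rw [measureReal_def (s := (Icc 0 T)ᶜ), hsupp, ENNReal.toReal_zero] at h1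
    have := hcell 0 hm
    push_cast at this h1 ⊢
    linarith
  | succ k ih =>
    have hsub : Iic ((((k + 1 : ℕ) : ℝ) + 1) / m * T) ⊆ Iic (((k : ℝ) + 1) / m * T) ∪
        Icc (((k + 1 : ℕ) : ℝ) / m * T) ((((k + 1 : ℕ) : ℝ) + 1) / m * T) := by
      intro x hx
      rcases le_total x (((k : ℝ) + 1) / m * T) with hle | hle
      · exact Or.inl hle
      · exact Or.inr ⟨by push_cast; exact hle, hx⟩
    have h1 := (measureReal_mono (μ := μ) hsub).trans (measureReal_union_le _ _)
    have h2 := ih (by omega)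
    have h3 := hcell (k + 1) hk
    push_cast at h1 h3 ⊢
    linarith

lemma real_Ioi_le_of_cells {μ : Measure ℝ} [IsFiniteMeasure μ] {T η : ℝ} {m : ℕ} (hm : 0 < m)
    (hsupp : μ (Icc 0 T)ᶜ = 0)
    (hcell : ∀ j < m, μ.real (Icc ((j : ℝ) / m * T) (((j : ℝ) + 1) / m * T)) ≤ 1 / m + η)
    {i : ℕ} (hi : i ≤ m) :
    μ.real (Ioi (((m : ℝ) - i) / m * T)) ≤ i * (1 / m + η) := by
  have hm' : (0 : ℝ) < m := by exact_mod_cast hm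
  induction i with
  | zero =>
    have hsub : Ioi (((m : ℝ) - (0 : ℕ)) / m * T) ⊆ (Icc 0 T)ᶜ := by
      intro x hx h
      rw [Nat.cast_zero, sub_zero, div_self hm'.ne', one_mul] at hx
      exact absurd h.2 (not_le.2 hx)
    have h1 := measureReal_mono (μ := μ) hsub
    rw [measureReal_def (s := (Icc 0 T)ᶜ), hsupp, ENNReal.toReal_zero] at h1
    simpa using h1
  | succ i ih =>
    have hcast : ((m - (i + 1) : ℕ) : ℝ) = (m : ℝ) - ((i + 1 : ℕ) : ℝ) := Nat.cast_sub hi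
    have h3 := hcell (m - (i + 1)) (by omega)
    rw [hcast] at h3
    have hsub : Ioi (((m : ℝ) - ((i + 1 : ℕ) : ℝ)) / m * T) ⊆
        Icc (((m : ℝ) - ((i + 1 : ℕ) : ℝ)) / m * T)
          (((m : ℝ) - ((i + 1 : ℕ) : ℝ) + 1) / m * T) ∪ Ioi (((m : ℝ) - i) / m * T) := by
      intro x hx
      have e : (m : ℝ) - ((i + 1 : ℕ) : ℝ) + 1 = m - i := by push_cast; ring
      rw [e]
      rcases le_or_gt x (((m : ℝ) - i) / m * T) with hle | hlt
      · exact Or.inl ⟨le_of_lt hx, hle⟩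
      · exact Or.inr hlt
    have h1 := (measureReal_mono (μ := μ) hsub).trans (measureReal_union_le _ _)
    have h2 := ih (by omega)
    push_cast at h1 h3 ⊢
    linarith

/-- Cells to the left of `x` bound the distribution function from above; cells to the right bound
its complement from above, hence the function from below. The error is one cell width plus `m` times
the cell error, each at most `ε / 2`. -/
lemma IsLocFamily.eventually_abs_cdf_sub_le (hρ : IsLocFamily ρ)
    (hcell : ∀ m j : ℕ, j < m → ∀ η > 0, ∀ᶠ T in atTop,
      (ρ T).real (Icc ((j : ℝ) / m * T) (((j : ℝ) + 1) / m * T)) ≤ 1 / m + η)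
    {ε : ℝ} (hε : 0 < ε) :
    ∀ᶠ T in atTop, ∀ x ∈ Icc (0 : ℝ) 1, |(ρ T).real (Iic (x * T)) - x| ≤ ε := by
  obtain ⟨m, hm⟩ := exists_nat_gt (2 / ε)
  have hm' : (0 : ℝ) < m := (by positivity : 0 < 2 / ε).trans hm
  have hm0 : 0 < m := by exact_mod_cast hm'
  have hmε : 1 / (m : ℝ) ≤ ε / 2 := by
    rw [div_lt_iff₀ hε] at hm
    rw [div_le_div_iff₀ hm' (by norm_num)]
    linarith
  have hη : 0 < ε / (2 * m) := by positivity
  have hall : ∀ᶠ T in atTop, ∀ j ∈ Finset.range m,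
      (ρ T).real (Icc ((j : ℝ) / m * T) (((j : ℝ) + 1) / m * T)) ≤ 1 / m + ε / (2 * m) :=
    (Filter.eventually_all_finset _).2 fun j hj => hcell m j (Finset.mem_range.1 hj) _ hη
  filter_upwards [hall, eventually_gt_atTop 0] with T hT hT0 x hx
  have := hρ.prob T hT0
  have hT' : ∀ j < m, (ρ T).real (Icc ((j : ℝ) / m * T) (((j : ℝ) + 1) / m * T)) ≤
      1 / m + ε / (2 * m) := fun j hj => hT j (Finset.mem_range.2 hj)
  have hxm : 0 ≤ x * m := mul_nonneg hx.1 hm'.le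
  set j := ⌊x * m⌋₊ with hj
  have hj1 : (j : ℝ) ≤ x * m := Nat.floor_le hxm
  have hj2 : x * m < j + 1 := Nat.lt_floor_add_one _
  have hjm : j ≤ m := by
    have : (j : ℝ) ≤ m := hj1.trans (mul_le_of_le_one_left hm'.le hx.2)
    exact_mod_cast this
  have hjm' : (j : ℝ) ≤ m := by exact_mod_cast hjm
  have hmm : (m : ℝ) * (ε / (2 * m)) = ε / 2 := by field_simp
  have hx1 : (j : ℝ) / m ≤ x := by rwa [div_le_iff₀ hm']
  have hx2 : x < ((j : ℝ) + 1) / m := by rwa [lt_div_iff₀ hm']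
  rw [add_div] at hx2
  rw [abs_le]
  constructor
  · have h1 := real_Ioi_le_of_cells hm0 (hρ.supp T hT0) hT' (Nat.sub_le m j)
    rw [Nat.cast_sub hjm, sub_sub_cancel] at h1
    have h2 : (ρ T).real (Ioi (j / m * T)) = 1 - (ρ T).real (Iic (j / m * T)) := by
      rw [← compl_Iic, probReal_compl_eq_one_sub measurableSet_Iic]
    have h3 : (ρ T).real (Iic (j / m * T)) ≤ (ρ T).real (Iic (x * T)) :=
      measureReal_mono (Iic_subset_Iic.2 (by gcongr))
    have h4 : ((m : ℝ) - j) * (1 / m + ε / (2 * m)) ≤ 1 - j / m + ε / 2 := by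
      have h5 : ((m : ℝ) - j) * (ε / (2 * m)) ≤ m * (ε / (2 * m)) := by
        gcongr
        linarith [(Nat.cast_nonneg j : (0 : ℝ) ≤ j)]
      have h6 : ((m : ℝ) - j) * (1 / m) = 1 - j / m := by field_simp
      rw [mul_add, h6]
      linarith
    linarith
  · rcases hjm.lt_or_eq with hlt | heq
    · have h1 := real_Iic_le_of_cells hm0 (hρ.supp T hT0) hT' hlt
      have h3 : (ρ T).real (Iic (x * T)) ≤ (ρ T).real (Iic (((j : ℝ) + 1) / m * T)) :=
        measureReal_mono (Iic_subset_Iic.2 (by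
          have : x ≤ ((j : ℝ) + 1) / m := by rw [add_div]; exact hx2.le
          gcongr))
      have h4 : ((j : ℝ) + 1) * (1 / m + ε / (2 * m)) ≤ j / m + 1 / m + ε / 2 := by
        have h5 : ((j : ℝ) + 1) * (ε / (2 * m)) ≤ m * (ε / (2 * m)) := by
          gcongr
          exact_mod_cast hlt
        have h6 : ((j : ℝ) + 1) * (1 / m) = j / m + 1 / m := by ring
        rw [mul_add, h6]
        linarith
      linarith
    -- Here `j = m` forces `x = 1`, and there is no further cell.
    · have h1 : (ρ T).real (Iic (x * T)) ≤ 1 := measureReal_le_one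
      rw [heq, div_self hm'.ne'] at hx1
      linarith

lemma real_Ioc_eq_sub (μ : Measure ℝ) [IsFiniteMeasure μ] {s t : ℝ} (hst : s ≤ t) :
    μ.real (Ioc s t) = μ.real (Iic t) - μ.real (Iic s) := by
  rw [← Iic_union_Ioc_eq_Iic hst, measureReal_union _ measurableSet_Ioc]
  · ring
  · rw [disjoint_left]
    exact fun z hz hz' => absurd hz (not_le.2 hz'.1)

/-! ### Bounds on the density -/

lemma tendsto_real_Ioc_div {μ : Measure ℝ} [IsFiniteMeasure μ] {f : ℝ → ℝ} {T y : ℝ}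
    (hy : y ∈ Ioo 0 T) (hf0 : ∀ t ∈ Ioo 0 T, 0 ≤ f t) (hf : ContinuousWithinAt f (Ici y) y)
    (hd : μ.restrict (Ioo 0 T) =
      (volume.restrict (Ioo 0 T)).withDensity fun t => ENNReal.ofReal (f t)) :
    Tendsto (fun e => μ.real (Ioc y (y + e)) / e) (𝓝[>] 0) (𝓝 (f y)) := by
  rw [Metric.tendsto_nhds]
  intro κ hκ
  obtain ⟨v, hyv, hv⟩ := (mem_nhdsGE_iff_exists_Ico_subset).1
    (hf (Metric.ball_mem_nhds (f y) (half_pos hκ)))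
  have hyv : y < v := hyv
  have hlim : 0 < min (v - y) (T - y) := lt_min (by linarith) (by linarith [hy.2])
  filter_upwards [Ioo_mem_nhdsGT hlim] with e he
  have he0 : 0 < e := he.1
  have hev : y + e < v := by linarith [he.2.trans_le (min_le_left _ _)]
  have heT : y + e < T := by linarith [he.2.trans_le (min_le_right _ _)]
  have hsub : Ioc y (y + e) ⊆ Ioo 0 T := fun s hs => ⟨hy.1.trans hs.1, hs.2.trans_lt heT⟩
  have hμ : μ (Ioc y (y + e)) = ∫⁻ s in Ioc y (y + e), ENNReal.ofReal (f s) := by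
    have := congrArg (fun ν => ν (Ioc y (y + e))) hd
    simp only [withDensity_apply _ measurableSet_Ioc, Measure.restrict_apply measurableSet_Ioc,
      Measure.restrict_restrict measurableSet_Ioc, inter_eq_self_of_subset_left hsub] at this
    exact this
  have hclose : ∀ s ∈ Ioc y (y + e), |f s - f y| < κ / 2 := fun s hs =>
    hv ⟨hs.1.le, hs.2.trans_lt hev⟩
  have hupper : μ (Ioc y (y + e)) ≤ ENNReal.ofReal ((f y + κ / 2) * e) := by
    rw [hμ]
    calc ∫⁻ s in Ioc y (y + e), ENNReal.ofReal (f s)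
        ≤ ∫⁻ _ in Ioc y (y + e), ENNReal.ofReal (f y + κ / 2) :=
          setLIntegral_mono' measurableSet_Ioc fun s hs => ENNReal.ofReal_le_ofReal
            (by linarith [(abs_lt.1 (hclose s hs)).2])
      _ = _ := by
          rw [setLIntegral_const, Real.volume_Ioc, add_sub_cancel_left,
            ENNReal.ofReal_mul' he0.le]
  have hlower : ENNReal.ofReal ((f y - κ / 2) * e) ≤ μ (Ioc y (y + e)) := by
    rw [hμ]
    calc ENNReal.ofReal ((f y - κ / 2) * e)
        = ∫⁻ _ in Ioc y (y + e), ENNReal.ofReal (f y - κ / 2) := by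
          rw [setLIntegral_const, Real.volume_Ioc, add_sub_cancel_left,
            ENNReal.ofReal_mul' he0.le]
      _ ≤ _ := setLIntegral_mono' measurableSet_Ioc fun s hs => ENNReal.ofReal_le_ofReal
            (by linarith [(abs_lt.1 (hclose s hs)).1])
  have hfy := hf0 y hy
  have h1 : μ.real (Ioc y (y + e)) ≤ (f y + κ / 2) * e := by
    have := ENNReal.toReal_mono ENNReal.ofReal_ne_top hupper
    rwa [ENNReal.toReal_ofReal (by positivity)] at this
  have h2 : (f y - κ / 2) * e ≤ μ.real (Ioc y (y + e)) :=
    (ENNReal.ofReal_le_iff_le_toReal (measure_ne_top _ _)).1 hlower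
  rw [Real.dist_eq, abs_lt]
  rw [← le_div_iff₀ he0] at h2
  rw [← div_le_iff₀ he0] at h1
  constructor <;> linarith

lemma tendsto_mul_real_Ioc {μ : Measure ℝ} [IsFiniteMeasure μ] {f : ℝ → ℝ} {T y Δ : ℝ}
    (hΔ : 0 < Δ) (hy : y ∈ Ioo 0 T) (hf0 : ∀ t ∈ Ioo 0 T, 0 ≤ f t)
    (hf : ContinuousWithinAt f (Ici y) y)
    (hd : μ.restrict (Ioo 0 T) =
      (volume.restrict (Ioo 0 T)).withDensity fun t => ENNReal.ofReal (f t)) :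
    Tendsto (fun N : ℕ => N * μ.real (Ioc y (y + Δ / N))) atTop (𝓝 (Δ * f y)) := by
  have h1 : Tendsto (fun N : ℕ => Δ / (N : ℝ)) atTop (𝓝[>] 0) := by
    refine tendsto_nhdsWithin_iff.2 ⟨tendsto_const_div_atTop_nhds_zero_nat Δ, ?_⟩
    filter_upwards [eventually_gt_atTop 0] with N hN
    have : (0 : ℝ) < N := by exact_mod_cast hN
    exact div_pos hΔ this
  refine (((tendsto_real_Ioc_div hy hf0 hf hd).comp h1).const_mul Δ).congr' ?_
  filter_upwards [eventually_gt_atTop 0] with N hN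
  have : (0 : ℝ) < N := by exact_mod_cast hN
  simp only [Function.comp_apply]
  field_simp

/-- The limit `N → ∞` of `mul_real_le`; right continuity makes the limit the value at the given
point, not merely at almost every point. -/
lemma IsLocFamily.mul_density_le (hρ : IsLocFamily ρ) {f : ℝ → ℝ} {T y Δ : ℝ}
    (hΔ : 0 < Δ) (hy : Δ ≤ y) (hyT : y + Δ ≤ T) (hf0 : ∀ t ∈ Ioo 0 T, 0 ≤ f t)
    (hf : ContinuousWithinAt f (Ici y) y)
    (hd : (ρ T).restrict (Ioo 0 T) =
      (volume.restrict (Ioo 0 T)).withDensity fun t => ENNReal.ofReal (f t)) :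
    Δ * f y ≤ (ρ (T - Δ)).real (Ioc (y - Δ) y) := by
  have := hρ.prob T (by linarith)
  refine le_of_tendsto (tendsto_mul_real_Ioc hΔ ⟨by linarith, by linarith⟩ hf0 hf hd) ?_
  filter_upwards [eventually_gt_atTop 0] with N hN
  exact hρ.mul_real_le hΔ hy hyT hN

lemma IsLocFamily.le_mul_density (hρ : IsLocFamily ρ) {f : ℝ → ℝ} {T y Δ : ℝ}
    (hΔ : 0 < Δ) (hy : y ∈ Ioo 0 T) (hf0 : ∀ t ∈ Ioo 0 T, 0 ≤ f t)
    (hf : ContinuousWithinAt f (Ici y) y)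
    (hd : (ρ T).restrict (Ioo 0 T) =
      (volume.restrict (Ioo 0 T)).withDensity fun t => ENNReal.ofReal (f t)) :
    (ρ (T + Δ)).real (Ioc y (y + Δ)) ≤ Δ * f y := by
  have := hρ.prob T (hy.1.trans hy.2)
  refine ge_of_tendsto (tendsto_mul_real_Ioc hΔ hy hf0 hf hd) ?_
  have h1 := (tendsto_order.1 (tendsto_const_div_atTop_nhds_zero_nat Δ)).2 (T - y)
    (by linarith [hy.2])
  filter_upwards [eventually_gt_atTop 0, h1] with N hN hlt
  exact hρ.le_mul_real hΔ hy.1.le hy.2 hN hlt.le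

/-- If the rescaled laws converge uniformly to the uniform distribution, then the rescaled
densities converge uniformly to `1` away from the end points. -/
theorem IsLocFamily.tendstoUniformlyOn_density (hρ : IsLocFamily ρ)
    (hcdf : ∀ ε > 0, ∀ᶠ T in atTop, ∀ x ∈ Icc (0 : ℝ) 1, |(ρ T).real (Iic (x * T)) - x| ≤ ε)
    {f : ℝ → ℝ → ℝ} (hf0 : ∀ T > 0, ∀ t ∈ Ioo 0 T, 0 ≤ f T t)
    (hf : ∀ T > 0, ∀ t ∈ Ioo 0 T, ContinuousWithinAt (f T) (Ici t) t)
    (hd : ∀ T > 0, (ρ T).restrict (Ioo 0 T) =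
      (volume.restrict (Ioo 0 T)).withDensity fun t => ENNReal.ofReal (f T t))
    {ε : ℝ} (hε : 0 < ε) :
    TendstoUniformlyOn (fun T t : ℝ => T * f T (t * T)) (fun _ => 1) atTop (Icc ε (1 - ε)) := by
  rw [Metric.tendstoUniformlyOn_iff]
  intro κ hκ
  -- The bound `ε / 2` keeps the comparison intervals inside the windows, `1 / 2` gives `1 / (1 - η)
  -- ≤ 1 + 2 * η`, and `κ / 4` makes `2 * η` at most `κ / 2`.
  set η := min (min (ε / 2) (κ / 4)) (1 / 2) with hη
  have hη0 : 0 < η := by positivity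
  have hηε : η ≤ ε / 2 := (min_le_left _ _).trans (min_le_left _ _)
  have hηκ : η ≤ κ / 4 := (min_le_left _ _).trans (min_le_right _ _)
  have hη2 : η ≤ 1 / 2 := min_le_right _ _
  -- Two distribution function errors enter and the result is divided by `η`, which leaves `κ / 4`.
  have hδ : 0 < η * κ / 8 := by positivity
  have hc1 := (tendsto_id.const_mul_atTop (show 0 < 1 - η by linarith)).eventually (hcdf _ hδ)
  have hc2 := (tendsto_id.const_mul_atTop (show 0 < 1 + η by linarith)).eventually (hcdf _ hδ)
  filter_upwards [hc1, hc2, eventually_gt_atTop 0] with T h1 h2 hT t ht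
  simp only [id_eq] at h1 h2
  have hy : t * T ∈ Ioo 0 T := ⟨by have := hε.trans_le ht.1; positivity, by nlinarith [ht.2]⟩
  have hηT : 0 < η * T := by positivity
  have hp1 := hρ.prob ((1 - η) * T) (by have : 0 < 1 - η := by linarith
                                        positivity)
  have hp2 := hρ.prob ((1 + η) * T) (by positivity)
  have hup := hρ.mul_density_le (T := T) (y := t * T) hηT (by nlinarith [ht.1])
    (by nlinarith [ht.2]) (hf0 T hT) (hf T hT _ hy) (hd T hT)
  have hlo := hρ.le_mul_density (T := T) (y := t * T) hηT hy (hf0 T hT) (hf T hT _ hy) (hd T hT)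
  rw [show T - η * T = (1 - η) * T by ring, real_Ioc_eq_sub _ (by linarith)] at hup
  rw [show T + η * T = (1 + η) * T by ring, real_Ioc_eq_sub _ (by linarith)] at hlo
  have hm : 0 < 1 - η := by linarith
  have hpl : 0 < 1 + η := by linarith
  have a1 := h1 (t / (1 - η)) ⟨by have := hε.trans_le ht.1; positivity,
    by rw [div_le_one hm]; linarith [ht.2]⟩
  have a2 := h1 ((t - η) / (1 - η)) ⟨div_nonneg (by linarith [ht.1]) hm.le,
    by rw [div_le_one hm]; linarith [ht.2]⟩
  have b1 := h2 ((t + η) / (1 + η)) ⟨div_nonneg (by linarith [ht.1]) hpl.le,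
    by rw [div_le_one hpl]; linarith [ht.2]⟩
  have b2 := h2 (t / (1 + η)) ⟨by have := hε.trans_le ht.1; positivity,
    by rw [div_le_one hpl]; linarith [ht.2]⟩
  rw [show t / (1 - η) * ((1 - η) * T) = t * T by field_simp, abs_le] at a1
  rw [show (t - η) / (1 - η) * ((1 - η) * T) = t * T - η * T by field_simp, abs_le] at a2
  rw [show (t + η) / (1 + η) * ((1 + η) * T) = t * T + η * T by field_simp, abs_le] at b1
  rw [show t / (1 + η) * ((1 + η) * T) = t * T by field_simp, abs_le] at b2
  have e1 : t / (1 - η) - (t - η) / (1 - η) = η / (1 - η) := by ring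
  have e2 : (t + η) / (1 + η) - t / (1 + η) = η / (1 + η) := by ring
  have u1 : η / (1 - η) ≤ η * (1 + 2 * η) := by
    rw [div_le_iff₀ hm]
    nlinarith [mul_nonneg hη0.le (mul_nonneg hη0.le (show 0 ≤ 1 - 2 * η by linarith))]
  have u2 : η * (1 - η) ≤ η / (1 + η) := by
    rw [le_div_iff₀ hpl]
    nlinarith [pow_pos hη0 3]
  have U : η * (T * f T (t * T)) ≤ η * (1 + 2 * η + κ / 4) := by nlinarith [a1.2, a2.1]
  have L : η * (1 - η - κ / 4) ≤ η * (T * f T (t * T)) := by nlinarith [b1.1, b2.2]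
  have U' := le_of_mul_le_mul_left U hη0
  have L' := le_of_mul_le_mul_left L hη0
  rw [Real.dist_eq, abs_lt]
  constructor <;> linarith

/-! ### Weak convergence to the uniform distribution -/

lemma isProbabilityMeasure_restrict_Ioo :
    IsProbabilityMeasure ((volume : Measure ℝ).restrict (Ioo 0 1)) :=
  ⟨by simp⟩

lemma real_restrict_Ioo_Ioc {a b : ℝ} (hab : a < b) :
    ((volume : Measure ℝ).restrict (Ioo 0 1)).real (Ioc a b) =
      max 0 (min b 1) - max 0 (min a 1) := by
  rw [Measure.restrict_congr_set Ioo_ae_eq_Ioc, measureReal_restrict_apply measurableSet_Ioc,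
    Ioc_inter_Ioc, Real.volume_real_Ioc]
  change max (min b 1 - max a 0) 0 = _
  rcases le_total a 0 with h1 | h1 <;> rcases le_total b 0 with h2 | h2 <;>
  rcases le_total a 1 with h3 | h3 <;> rcases le_total b 1 with h4 | h4 <;>
  simp [h1, h2, h3, h4] <;> linarith

lemma IsLocFamily.tendsto_real_Iic (hρ : IsLocFamily ρ)
    (hcdf : ∀ ε > 0, ∀ᶠ T in atTop, ∀ x ∈ Icc (0 : ℝ) 1, |(ρ T).real (Iic (x * T)) - x| ≤ ε)
    (x : ℝ) : Tendsto (fun T => (ρ T).real (Iic (x * T))) atTop (𝓝 (max 0 (min x 1))) := by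
  rcases lt_or_ge x 0 with hx | hx
  · rw [min_eq_left (by linarith), max_eq_left hx.le]
    refine tendsto_const_nhds.congr' ?_
    filter_upwards [eventually_gt_atTop 0] with T hT
    have hsub : Iic (x * T) ⊆ (Icc 0 T)ᶜ := fun s hs h => by
      have h1 : s ≤ x * T := hs
      nlinarith [h.1]
    rw [measureReal_def, measure_mono_null hsub (hρ.supp T hT), ENNReal.toReal_zero]
  rcases le_or_gt x 1 with hx1 | hx1
  · rw [min_eq_left hx1, max_eq_right hx, Metric.tendsto_nhds]
    intro ε hε
    filter_upwards [hcdf (ε / 2) (half_pos hε)] with T hT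
    rw [Real.dist_eq]
    linarith [hT x ⟨hx, hx1⟩]
  · rw [min_eq_right hx1.le, max_eq_right zero_le_one]
    refine tendsto_const_nhds.congr' ?_
    filter_upwards [eventually_gt_atTop 0] with T hT
    have := hρ.prob T hT
    have hsub : (Iic (x * T))ᶜ ⊆ (Icc 0 T)ᶜ := compl_subset_compl.2 fun s hs => by
      have h1 : s ≤ T := hs.2
      change s ≤ x * T
      nlinarith
    have h0 : (ρ T).real (Iic (x * T))ᶜ = 0 := by
      rw [measureReal_def, measure_mono_null hsub (hρ.supp T hT), ENNReal.toReal_zero]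
    rw [probReal_compl_eq_one_sub measurableSet_Iic] at h0
    linarith

/-- The rescaled laws converge weakly to the uniform distribution on `(0, 1)`. -/
theorem IsLocFamily.tendsto_integral (hρ : IsLocFamily ρ)
    (hcdf : ∀ ε > 0, ∀ᶠ T in atTop, ∀ x ∈ Icc (0 : ℝ) 1, |(ρ T).real (Iic (x * T)) - x| ≤ ε)
    (g : BoundedContinuousFunction ℝ ℝ) :
    Tendsto (fun T : ℝ => ∫ x, g x ∂((ρ T).map fun s => s / T)) atTop
      (𝓝 (∫ x in Ioo (0 : ℝ) 1, g x)) := by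
  have hdiv : ∀ T : ℝ, Measurable fun s : ℝ => s / T := fun T => measurable_id.div_const T
  have hprob : ∀ T : ℝ, IsProbabilityMeasure ((ρ (max T 1)).map fun s => s / max T 1) := fun T => by
    have := hρ.prob (max T 1) (lt_max_of_lt_right one_pos)
    exact Measure.isProbabilityMeasure_map (hdiv _).aemeasurable
  -- Replacing `T` by `max T 1` gives a probability measure for every real `T` and changes nothing
  -- for `T ≥ 1`.
  let μs : ℝ → ProbabilityMeasure ℝ := fun T => ⟨(ρ (max T 1)).map fun s => s / max T 1, hprob T⟩
  let ν : ProbabilityMeasure ℝ := ⟨volume.restrict (Ioo 0 1), isProbabilityMeasure_restrict_Ioo⟩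
  have hconv : Tendsto μs atTop (𝓝 ν) := by
    refine (isPiSystem_Ioc (id : ℝ → ℝ) id).tendsto_probabilityMeasure_of_tendsto_of_mem ?_ ?_ ?_
    · rintro _ ⟨a, b, -, rfl⟩
      exact measurableSet_Ioc
    · intro u hu x hx
      obtain ⟨δ, hδ, hball⟩ := Metric.isOpen_iff.1 hu x hx
      refine ⟨Ioc (x - δ / 2) (x + δ / 2), ⟨x - δ / 2, x + δ / 2, by simp only [id_eq]; linarith, rfl⟩,
        Ioc_mem_nhds (by linarith) (by linarith), fun s hs => hball ?_⟩
      rw [Metric.mem_ball, Real.dist_eq, abs_lt]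
      constructor <;> linarith [hs.1, hs.2]
    · rintro _ ⟨a, b, hab, rfl⟩
      simp only [id_eq] at hab ⊢
      rw [← NNReal.tendsto_coe]
      have hν : ((ν (Ioc a b) : NNReal) : ℝ) = max 0 (min b 1) - max 0 (min a 1) :=
        real_restrict_Ioo_Ioc hab
      rw [hν]
      refine ((hρ.tendsto_real_Iic hcdf b).sub (hρ.tendsto_real_Iic hcdf a)).congr' ?_
      filter_upwards [eventually_ge_atTop 1] with T hT
      have hT0 : 0 < T := one_pos.trans_le hT
      have := hρ.prob T hT0
      change _ = ((ρ (max T 1)).map fun s => s / max T 1).real (Ioc a b)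
      rw [max_eq_left hT, map_measureReal_apply (hdiv T) measurableSet_Ioc,
        ← real_Ioc_eq_sub _ (by gcongr)]
      congr 1
      ext s
      simp only [mem_Ioc, mem_preimage, lt_div_iff₀ hT0, div_le_iff₀ hT0]
  refine ((ProbabilityMeasure.tendsto_iff_forall_integral_tendsto.1 hconv) g).congr' ?_
  filter_upwards [eventually_ge_atTop 1] with T hT
  change ∫ x, g x ∂((ρ (max T 1)).map fun s => s / max T 1) = _
  rw [max_eq_left hT]

end SupLocation

end

/-! ### The main theorem -/

theorem theorem4p1 {Ω : Type*} [MeasurableSpace Ω] (P : Measure Ω) [IsProbabilityMeasure P]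
    (X : ℝ → Ω → ℝ) (hmeas : ∀ t, Measurable (X t))
    (husc : SupLocation.SampleUSC X)
    (hsep : SupLocation.IsSupSeparable X P)
    (hstat : SupLocation.IsStationary X P)
    (htail : SupLocation.TailSM X P)
    (hatom : SupLocation.AtomsVanish X P) :
    -- the supremum location is a random variable, with a right continuous density with left limits
    (∀ T : ℝ, 0 < T → AEMeasurable (SupLocation.supLoc X 0 T) P ∧
      ∃ f : ℝ → ℝ, SupLocation.IsSupLocDensity X P T f) ∧
    -- uniform convergence of the (unique) rescaled density
    (∀ f : ℝ → ℝ → ℝ, (∀ T : ℝ, 0 < T → SupLocation.IsSupLocDensity X P T (f T)) →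
      ∀ ε : ℝ, 0 < ε → ε < 1 / 2 →
        TendstoUniformlyOn (fun T t : ℝ => T * f T (t * T)) (fun _ => 1) atTop
          (Icc ε (1 - ε))) ∧
    -- weak convergence of the rescaled location to the uniform distribution
    (∀ g : BoundedContinuousFunction ℝ ℝ,
      Tendsto (fun T : ℝ => ∫ x, g x ∂(P.map fun ω => SupLocation.supLoc X 0 T ω / T)) atTop
        (𝓝 (∫ x in Ioo (0 : ℝ) 1, g x))) := by
  have hρ := SupLocation.isLocFamily_map_supLoc hmeas husc hsep hstat
  have hm : ∀ T : ℝ, 0 < T → AEMeasurable (SupLocation.supLoc X 0 T) P := fun T hT =>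
    SupLocation.aemeasurable_supLoc hmeas husc hsep hT.le
  have hcdf := fun (ε : ℝ) (hε : ε > 0) => hρ.eventually_abs_cdf_sub_le (ε := ε)
    (fun m j hj η hη => by
      filter_upwards [SupLocation.eventually_supLoc_mem_cell_le hmeas husc hsep hstat htail hatom
        hj hη, eventually_gt_atTop 0] with T hT hT0
      rwa [map_measureReal_apply_of_aemeasurable (hm T hT0) measurableSet_Icc]) hε
  refine ⟨fun T hT => ⟨hm T hT, ?_⟩, fun f hf ε hε _ => ?_, fun g => ?_⟩
  · obtain ⟨f, h1, h2, h3, h4⟩ := hρ.exists_density hT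
    exact ⟨f, h1, h2, h3, h4⟩
  · exact hρ.tendstoUniformlyOn_density hcdf (fun T hT => (hf T hT).nonneg)
      (fun T hT => (hf T hT).rightCts) (fun T hT => (hf T hT).density) hε
  · refine (hρ.tendsto_integral hcdf g).congr' ?_
    filter_upwards [eventually_gt_atTop 0] with T hT
    rw [AEMeasurable.map_map_of_aemeasurable
      (show Measurable fun s : ℝ => s / T from measurable_id.div_const T).aemeasurable (hm T hT)]
    rfl
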